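/- **Programs.** Fix $N\in\mathbb N$ and $\mathsf{DOM}=\{-N,\dots,N\}$. Programs are finite sequences of uniquely labelled statements, ending in $\mathsf{exit}$, over finitely many Boolean, $\mathsf{DOM}$, integer and real variables, with a set of input and a set of output variables among the $\mathsf{DOM}$ variables. Expressions are $B ::= \mathsf{true}\mid\mathsf{false}\mid b\mid \neg B\mid B\wedge B\mid B\vee B\mid g(\tilde E)$, $E::=d\mid x\mid f(\tilde E)$, $Z::=z\mid iZ\mid EZ\mid Z+Z\mid Z+i\mid Z+E$ ($i\in\mathbb Z$), $R::=r\mid qR\mid ER\mid R+R\mid R+q\mid R+E$ ($q\in\mathbb Q$). Statements are the assignments $x\gets E$, $z\gets Z$, $r\gets R$, $b\gets B$, comparisons $b\gets Z\sim Z$, $b\gets Z\sim E$, $b\gets R\sim R$, $b\gets R\sim E$ with $\sim\,\in\{<,>,=,\le,\ge\}$, samplings (with $a\in\mathbb Q^{>0}$) $r\gets \mathrm{Lap}(a\epsilon,E)$ (density $\frac{a\epsilon}{2}e^{-a\epsilon|y-E|}$), $z\gets\mathrm{DLap}(a\epsilon,E)$ (mass $\frac{1-e^{-a\epsilon}}{1+e^{-a\epsilon}}e^{-a\epsilon|i-E|}$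 on $\mathbb Z$), $x\gets\mathrm{Exp}(a\epsilon,F(\tilde x),E)$ (mass on $v\in\mathsf{DOM}$ proportional to $e^{a\epsilon F(\tilde x)(E,v)}$, $F$ rational-valued), $x\gets\mathsf{choose}(a\epsilon,\tilde E)$ (a user-defined distribution on $\mathsf{DOM}$), and $\mathsf{if}$, $\mathsf{while}$, $\mathsf{exit}$. The restricted class consists of the programs in which no integer or real variable is assigned within the scope of a $\mathsf{while}$ and each integer or real variable is assigned at most once (the two branches of an $\mathsf{if}$ may assign the same variable). As a standing assumption, in almost every execution on the given input and for the given $\epsilon$, every variable that is not an input variable has been assigned before it is referred to; an $\mathsf{exit}$ statement is taken to refer to the output variables. **Kernel semantics.** A state consists of the label of the next statement and values of all variables, with the product of the discrete and the Borel $\sigma$-algebras. The kernel $K_\epsilon$ executes one statement, each sampling being independent of the past; $\mathsf{exit}$ stays in place. Initially the input variables have the values $\mathbf{in}$ and all other variables are $\mathsf{false}$ or $0$. Let $\phi_i$ be the law of the first $i$ states of the resulting Markov chain. Then $\mathrm{Prob}_{natural}(P_\epsilon(\mathbf{in})=\mathbf{out})=\sum_{i>0}\phi_i(Req_i)$, where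 $Req_i$ is the set of $(s_1,\dots,s_i)$ such that $s_i$ is at an $\mathsf{exit}$ statement with values $\mathbf{out}$ of the output variables, and no earlier $s_j$ is at an $\mathsf{exit}$ statement. **DTMC semantics.** A state is a tuple $(\ell,f_{Bool},f_{\mathsf{DOM}},f_{int},f_{real},C)$: a label, partial valuations of the Boolean and the $\mathsf{DOM}$ variables, partial functions mapping an integer or real variable to the expression assigned to it (with the $\mathsf{DOM}$ subexpressions replaced by their values) or to the parameters $(a,d)$ of the distribution $\mathrm{DLap}(a\epsilon,d)$ or $\mathrm{Lap}(a\epsilon,d)$ from which it was sampled, and a set $C$ of (negated) comparisons from the program, with $\mathsf{DOM}$ subexpressions replaced by values. There are finitely many states. Integer and real assignments, including samplings, deterministically update $f_{int}$ or $f_{real}$; $\mathsf{DOM}$ samplings $x\gets\cdot$ move to $f_{\mathsf{DOM}}[x\mapsto d]$ with the probability of $d$; the assignments $x\gets E$ and $b\gets B$, $\mathsf{if}$, $\mathsf{while}$ and $\mathsf{exit}$ are executed deterministically as usual. For $b\gets c$ with a comparison $c$ (its $\mathsf{DOM}$ subexpressions evaluated), let $p$ be the conditional probability of $c$ given $C$,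 with independent samples having the parameters recorded in $f_{int},f_{real}$ and the other values determined by the recorded expressions ($p=0$ if $C$ has probability $0$); the chain moves to $b=\mathsf{true}$, $C\cup\{c\}$ with probability $p$ and to $b=\mathsf{false}$, $C\cup\{\neg c\}$ with probability $1-p$. Initially $f_{\mathsf{DOM}}=\mathbf{in}$ is defined on the input variables only, the other partial functions are undefined everywhere, and $C=\emptyset$. $\mathrm{Prob}_{DTMC}(P_\epsilon(\mathbf{in})=\mathbf{out})$ is the probability of reaching, from this state, the set of states at an $\mathsf{exit}$ statement in which $f_{\mathsf{DOM}}$ assigns $\mathbf{out}$ to the output variables. **Theorem.** For every program $P_\epsilon$ of the restricted class, every $\epsilon>0$, and all valuations $\mathbf{in}$ of the input variables and $\mathbf{out}$ of the output variables, $$\mathrm{Prob}_{DTMC}(P_\epsilon(\mathbf{in})=\mathbf{out})=\mathrm{Prob}_{natural}(P_\epsilon(\mathbf{in})=\mathbf{out}).$$ -/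

import Mathlib

open MeasureTheory ProbabilityTheory
open scoped ENNReal

namespace DP

noncomputable section

/-! ### Parametrized discrete-time Markov chains -/

/-- The range of the parameter `ε`. -/
abbrev PosReal : Type := {x : ℝ // 0 < x}

/-- Positive rationals: the constants `a` in `a ε`. -/
abbrev PosRat : Type := {q : ℚ // 0 < q}

/-- The number `a ε`. -/
def scale (a : PosRat) (ε : PosReal) : PosReal :=
  ⟨((a : ℚ) : ℝ) * (ε : ℝ), mul_pos (by exact_mod_cast a.2) ε.2⟩

/-- A parametrized DTMC: a countable set of states and, for every state and every parameter value,
a probability distribution on the successor states. -/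
structure ParamDTMC where
  State : Type
  countable : Countable State
  trans : State → PosReal → PMF State

namespace ParamDTMC

/-- The probability of a finite sequence of states. -/
def pathProb (M : ParamDTMC) (ε : PosReal) {m : ℕ} (ρ : Fin (m + 1) → M.State) : ℝ≥0∞ :=
  ∏ i : Fin m, M.trans (ρ i.castSucc) ε (ρ i.succ)

/-- The sequences `z₀, …, zₘ` that end in `T` and have no earlier state in `T`. -/
def pathsTo (M : ParamDTMC) (z₀ : M.State) (T : Set M.State) (m : ℕ) :
    Set (Fin (m + 1) → M.State) :=
  {ρ | ρ 0 = z₀ ∧ ρ (Fin.last m) ∈ T ∧ ∀ j : Fin m, ρ j.castSucc ∉ T}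

/-- The probability of reaching `T` from `z₀`. -/
def reachProb (M : ParamDTMC) (z₀ : M.State) (T : Set M.State) (ε : PosReal) : ℝ≥0∞ :=
  ∑' m : ℕ, ∑' ρ : M.pathsTo z₀ T m, M.pathProb ε ρ.1

end ParamDTMC

/-! ### The distributions -/

theorem lintegral_laplace (c : PosReal) (μ : ℝ) :
    ∫⁻ x : ℝ, ENNReal.ofReal ((c : ℝ) / 2 * Real.exp (-(c : ℝ) * |x - μ|)) = 1 := by
  obtain ⟨c, hc⟩ := c
  have h1 : ∫ x : ℝ, c / 2 * Real.exp (-c * |x - μ|) = 1 := by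
    rw [integral_sub_right_eq_self (fun x : ℝ => c / 2 * Real.exp (-c * |x|)) μ]
    rw [integral_const_mul, integral_comp_abs (f := fun x => Real.exp (-c * x)),
      integral_exp_mul_Ioi (by linarith) 0]
    simp
    field_simp
  have h2 : Integrable (fun x : ℝ => c / 2 * Real.exp (-c * |x - μ|)) :=
    Integrable.of_integral_ne_zero (by rw [h1]; exact one_ne_zero)
  rw [← ofReal_integral_eq_lintegral_ofReal h2 (Filter.Eventually.of_forall fun x => by positivity),
    h1, ENNReal.ofReal_one]

/-- The Laplace distribution `Lap(c, μ)` with density `(c / 2) exp (-c |x - μ|)`. -/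
def lap (c : PosReal) (μ : ℝ) : Measure ℝ :=
  volume.withDensity fun x => ENNReal.ofReal ((c : ℝ) / 2 * Real.exp (-(c : ℝ) * |x - μ|))

instance (c : PosReal) (μ : ℝ) : IsProbabilityMeasure (lap c μ) :=
  ⟨by rw [lap, withDensity_apply _ MeasurableSet.univ, setLIntegral_univ, lintegral_laplace]⟩

theorem hasSum_discreteLaplace (c : PosReal) (μ : ℤ) :
    HasSum (fun i : ℤ => (1 - Real.exp (-(c : ℝ))) / (1 + Real.exp (-(c : ℝ))) *
      Real.exp (-(c : ℝ) * |(i : ℝ) - (μ : ℝ)|)) 1 := by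
  obtain ⟨c, hc⟩ := c
  simp only
  set q := Real.exp (-c) with hq
  have hq0 : 0 < q := Real.exp_pos _
  have hq1 : q < 1 := by rw [hq, Real.exp_lt_one_iff]; linarith
  have hpow : ∀ n : ℕ, Real.exp (-c * n) = q ^ n := fun n => by
    rw [hq, ← Real.exp_nat_mul]; ring_nf
  have hg := hasSum_geometric_of_lt_one hq0.le hq1
  have h0 : HasSum (fun i : ℤ => Real.exp (-c * |(i : ℝ)|)) ((1 - q)⁻¹ + q * (1 - q)⁻¹) := by
    refine HasSum.of_nat_of_neg_add_one ?_ ?_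
    · refine hg.congr_fun ?_
      intro n
      rw [← hpow]
      simp
    · refine (hg.mul_left q).congr_fun ?_
      intro n
      have : |(((-((n : ℤ) + 1) : ℤ)) : ℝ)| = ((n + 1 : ℕ) : ℝ) := by
        push_cast
        rw [abs_neg, abs_of_nonneg (by positivity)]
      rw [this, hpow]; ring
  have h1 : HasSum (fun i : ℤ => Real.exp (-c * |(i : ℝ) - (μ : ℝ)|))
      ((1 - q)⁻¹ + q * (1 - q)⁻¹) := by
    have := (Equiv.subRight μ).hasSum_iff.mpr h0
    refine this.congr_fun ?_
    intro i
    simp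
  have h2 := h1.mul_left ((1 - q) / (1 + q))
  have hne : (1 - q) ≠ 0 := by linarith
  have : (1 - q) / (1 + q) * ((1 - q)⁻¹ + q * (1 - q)⁻¹) = 1 := by
    field_simp
  rwa [this] at h2

/-- The discrete Laplace distribution `DLap(c, μ)` with mass function
`i ↦ (1 - exp (-c)) / (1 + exp (-c)) * exp (-c |i - μ|)`. -/
def dLap (c : PosReal) (μ : ℤ) : PMF ℤ :=
  ⟨fun i => ENNReal.ofReal ((1 - Real.exp (-(c : ℝ))) / (1 + Real.exp (-(c : ℝ))) *
      Real.exp (-(c : ℝ) * |(i : ℝ) - (μ : ℝ)|)), by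
    have h := hasSum_discreteLaplace c μ
    have hnn : ∀ i : ℤ, 0 ≤ (1 - Real.exp (-(c : ℝ))) / (1 + Real.exp (-(c : ℝ))) *
        Real.exp (-(c : ℝ) * |(i : ℝ) - (μ : ℝ)|) := fun i => by
      have : Real.exp (-(c : ℝ)) ≤ 1 := Real.exp_le_one_iff.mpr (by linarith [c.2])
      have h3 : 0 ≤ 1 - Real.exp (-(c : ℝ)) := by linarith
      positivity
    have h2 := ENNReal.ofReal_tsum_of_nonneg hnn h.summable
    rw [h.tsum_eq, ENNReal.ofReal_one] at h2
    rw [h2]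
    exact ENNReal.summable.hasSum⟩

/-- The exponential mechanism: the probability of `v` is proportional to `exp (c * score v)`. -/
def expMech {V : Type} [Fintype V] [Nonempty V] (c : PosReal) (score : V → ℚ) : PMF V :=
  PMF.ofFintype (fun v => ENNReal.ofReal
    (Real.exp ((c : ℝ) * (score v : ℝ)) / ∑ w, Real.exp ((c : ℝ) * (score w : ℝ)))) (by
      have hpos : 0 < ∑ w, Real.exp ((c : ℝ) * (score w : ℝ)) :=
        Finset.sum_pos (fun w _ => Real.exp_pos _) Finset.univ_nonempty
      rw [← ENNReal.ofReal_sum_of_nonneg (fun v _ => by positivity), ← Finset.sum_div,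
        div_self hpos.ne', ENNReal.ofReal_one])

/-- The distribution on the Booleans with probability `p` of `true` and `1 - p` of `false`. -/
def coin (p : ℝ≥0∞) (hp : p ≤ 1) : PMF Bool :=
  PMF.ofFintype (fun t => if t then p else 1 - p) (by simp [add_tsub_cancel_of_le hp])

/-! ### Syntax -/

/-- The finite data over which a program is written: `N` bounds the finite domain
`DOM = {-N, …, N}`, and the other fields are the numbers of labels and of variables of the four
types. -/
structure Sig where
  N : ℕ
  numLabels : ℕ
  numBool : ℕ
  numDom : ℕ
  numInt : ℕ
  numReal : ℕ

namespace Sig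

variable (σ : Sig)

abbrev Dom : Type := Finset.Icc (-(σ.N : ℤ)) (σ.N : ℤ)
abbrev Label : Type := Fin σ.numLabels
abbrev BVar : Type := Fin σ.numBool
abbrev XVar : Type := Fin σ.numDom
abbrev ZVar : Type := Fin σ.numInt
abbrev RVar : Type := Fin σ.numReal

instance : Zero σ.Dom := ⟨⟨0, by simp⟩⟩

end Sig

variable {σ : Sig}

/-- Program variables of all types. -/
inductive Var (σ : Sig) : Type
  | bool (b : σ.BVar)
  | dom (x : σ.XVar)
  | int (z : σ.ZVar)
  | real (r : σ.RVar)

/-- The integer and the real variables. -/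
def Var.IsNumeric : Var σ → Prop
  | .bool _ => False
  | .dom _ => False
  | .int _ => True
  | .real _ => True

/-- `DOM` expressions: `d | x | f(E, …, E)`. -/
inductive DExp (σ : Sig) : Type
  | const (d : σ.Dom)
  | var (x : σ.XVar)
  | app {k : ℕ} (f : (Fin k → σ.Dom) → σ.Dom) (args : Fin k → DExp σ)

/-- Boolean expressions. -/
inductive BExp (σ : Sig) : Type
  | tt
  | ff
  | var (b : σ.BVar)
  | not (e : BExp σ)
  | and (e₁ e₂ : BExp σ)
  | or (e₁ e₂ : BExp σ)
  | app {k : ℕ} (g : (Fin k → σ.Dom) → Bool) (args : Fin k → DExp σ)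

/-- Integer expressions: `z | i Z | E Z | Z + Z | Z + i | Z + E`. -/
inductive IExp (σ : Sig) : Type
  | var (z : σ.ZVar)
  | constMul (i : ℤ) (e : IExp σ)
  | domMul (d : DExp σ) (e : IExp σ)
  | add (e₁ e₂ : IExp σ)
  | addConst (e : IExp σ) (i : ℤ)
  | addDom (e : IExp σ) (d : DExp σ)

/-- Real expressions: `r | q R | E R | R + R | R + q | R + E`. -/
inductive RExp (σ : Sig) : Type
  | var (r : σ.RVar)
  | constMul (q : ℚ) (e : RExp σ)
  | domMul (d : DExp σ) (e : RExp σ)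
  | add (e₁ e₂ : RExp σ)
  | addConst (e : RExp σ) (q : ℚ)
  | addDom (e : RExp σ) (d : DExp σ)

/-- Comparison symbols. -/
inductive Rel : Type
  | lt | gt | eq | le | ge

/-- Comparisons `Z ∼ Z`, `Z ∼ E`, `R ∼ R`, `R ∼ E`. -/
inductive CExp (σ : Sig) : Type
  | intInt (rel : Rel) (e₁ e₂ : IExp σ)
  | intDom (rel : Rel) (e : IExp σ) (d : DExp σ)
  | realReal (rel : Rel) (e₁ e₂ : RExp σ)
  | realDom (rel : Rel) (e : RExp σ) (d : DExp σ)

/-- Assignment statements. -/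
inductive Asgn (σ : Sig) : Type
  /-- `x ← E` -/
  | dom (x : σ.XVar) (e : DExp σ)
  /-- `x ← Exp(a ε, F(xs), E)`; the score of the candidate `v` on the value `u` of `E` is
  `F xs u v`. -/
  | expo (x : σ.XVar) (a : PosRat) {k : ℕ} (F : (Fin k → σ.Dom) → σ.Dom → σ.Dom → ℚ)
      (xs : Fin k → σ.XVar) (e : DExp σ)
  /-- `x ← choose(a ε, E, …, E)`; `D c ds` is the user-defined distribution for the value `c` of
  `a ε` and the values `ds` of the expressions. -/
  | choose (x : σ.XVar) (a : PosRat) {k : ℕ} (D : PosReal → (Fin k → σ.Dom) → PMF σ.Dom)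
      (es : Fin k → DExp σ)
  /-- `z ← Z` -/
  | int (z : σ.ZVar) (e : IExp σ)
  /-- `z ← DLap(a ε, E)` -/
  | dLap (z : σ.ZVar) (a : PosRat) (e : DExp σ)
  /-- `r ← R` -/
  | real (r : σ.RVar) (e : RExp σ)
  /-- `r ← Lap(a ε, E)` -/
  | lap (r : σ.RVar) (a : PosRat) (e : DExp σ)
  /-- `b ← B` -/
  | bool (b : σ.BVar) (e : BExp σ)
  /-- `b ← e₁ ∼ e₂` -/
  | cmp (b : σ.BVar) (c : CExp σ)

/-- Finite (possibly empty) sequences of labelled statements; the last argument of each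
constructor other than `nil` is the remainder of the sequence. -/
inductive Block (σ : Sig) : Type
  | nil
  | asgn (l : σ.Label) (a : Asgn σ) (rest : Block σ)
  | exit (l : σ.Label) (rest : Block σ)
  | ite (l : σ.Label) (c : BExp σ) (p q : Block σ) (rest : Block σ)
  | while (l : σ.Label) (c : BExp σ) (body : Block σ) (rest : Block σ)

/-- A program: input variables, output variables and a sequence of labelled statements. The
statements are those of `body`, followed by a last statement `last : exit`. -/
structure Program (σ : Sig) where
  inputs : Finset σ.XVar
  outputs : Finset σ.XVar
  body : Block σ
  last : σ.Label

/-! ### Control flow -/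

/-- A statement as seen by the operational semantics, together with the labels of the statements
to be executed next. -/
inductive Instr (σ : Sig) : Type
  | exit
  | asgn (a : Asgn σ) (next : σ.Label)
  | branch (c : BExp σ) (ifTrue ifFalse : σ.Label)

namespace Block

/-- The label of the first statement of a block that is followed by the label `follow`. -/
def entry : Block σ → (follow : σ.Label) → σ.Label
  | nil, follow => follow
  | asgn l _ _, _ => l
  | exit l _, _ => l
  | ite l _ _ _ _, _ => l
  | .while l _ _ _, _ => l

/-- The statement with a given label in a block that is followed by the label `follow`. -/
def instrAt : Block σ → (follow : σ.Label) → (query : σ.Label) → Option (Instr σ)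
  | nil, _, _ => none
  | asgn l a rest, follow, query =>
      if query = l then some (.asgn a (rest.entry follow)) else rest.instrAt follow query
  | exit l rest, follow, query =>
      if query = l then some .exit else rest.instrAt follow query
  | ite l c p q rest, follow, query =>
      if query = l then
        some (.branch c (p.entry (rest.entry follow)) (q.entry (rest.entry follow)))
      else
        ((p.instrAt (rest.entry follow) query).or (q.instrAt (rest.entry follow) query)).or
          (rest.instrAt follow query)
  | .while l c body rest, follow, query =>
      if query = l then some (.branch c (body.entry l) (rest.entry follow))
      else (body.instrAt l query).or (rest.instrAt follow query)

/-- The labels of a block, with multiplicity. -/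
def labels : Block σ → List σ.Label
  | nil => []
  | asgn l _ rest => l :: rest.labels
  | exit l rest => l :: rest.labels
  | ite l _ p q rest => l :: (p.labels ++ q.labels ++ rest.labels)
  | .while l _ body rest => l :: (body.labels ++ rest.labels)

end Block

/-- The label of the first statement. -/
def Program.start (P : Program σ) : σ.Label := P.body.entry P.last

/-- The statement with label `l`. The default value covers the label of the last `exit` (and
elements of `σ.Label` that are not labels of the program, which are never reached). -/
def Program.instr (P : Program σ) (l : σ.Label) : Instr σ :=
  (P.body.instrAt P.last l).getD .exit

/-! ### Variables read and assigned -/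

def DExp.vars : DExp σ → Set (Var σ)
  | const _ => ∅
  | var x => {.dom x}
  | app _ args => ⋃ i, (args i).vars

def BExp.vars : BExp σ → Set (Var σ)
  | tt => ∅
  | ff => ∅
  | var b => {.bool b}
  | not e => e.vars
  | and e₁ e₂ => e₁.vars ∪ e₂.vars
  | or e₁ e₂ => e₁.vars ∪ e₂.vars
  | app _ args => ⋃ i, (args i).vars

def IExp.vars : IExp σ → Set (Var σ)
  | var z => {.int z}
  | constMul _ e => e.vars
  | domMul d e => d.vars ∪ e.vars
  | add e₁ e₂ => e₁.vars ∪ e₂.vars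
  | addConst e _ => e.vars
  | addDom e d => e.vars ∪ d.vars

def RExp.vars : RExp σ → Set (Var σ)
  | var r => {.real r}
  | constMul _ e => e.vars
  | domMul d e => d.vars ∪ e.vars
  | add e₁ e₂ => e₁.vars ∪ e₂.vars
  | addConst e _ => e.vars
  | addDom e d => e.vars ∪ d.vars

def CExp.vars : CExp σ → Set (Var σ)
  | intInt _ e₁ e₂ => e₁.vars ∪ e₂.vars
  | intDom _ e d => e.vars ∪ d.vars
  | realReal _ e₁ e₂ => e₁.vars ∪ e₂.vars
  | realDom _ e d => e.vars ∪ d.vars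

/-- The variable that is assigned. -/
def Asgn.target : Asgn σ → Var σ
  | dom x _ => .dom x
  | expo x _ _ _ _ => .dom x
  | choose x _ _ _ => .dom x
  | int z _ => .int z
  | dLap z _ _ => .int z
  | real r _ => .real r
  | lap r _ _ => .real r
  | bool b _ => .bool b
  | cmp b _ => .bool b

/-- The variables on the right-hand side. -/
def Asgn.reads : Asgn σ → Set (Var σ)
  | dom _ e => e.vars
  | expo _ _ _ xs e => (Set.range fun i => Var.dom (xs i)) ∪ e.vars
  | choose _ _ _ es => ⋃ i, (es i).vars
  | int _ e => e.vars
  | dLap _ _ e => e.vars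
  | real _ e => e.vars
  | lap _ _ e => e.vars
  | bool _ e => e.vars
  | cmp _ c => c.vars

/-- The variables to which the statement with label `l` refers; an `exit` statement refers to the
output variables. -/
def Program.readsAt (P : Program σ) (l : σ.Label) : Set (Var σ) :=
  match P.instr l with
  | .exit => {v | ∃ x ∈ P.outputs, v = .dom x}
  | .asgn a _ => a.reads
  | .branch c _ _ => c.vars

/-- The statement with label `l` is an assignment to `v`. -/
def Program.AssignsAt (P : Program σ) (l : σ.Label) (v : Var σ) : Prop :=
  ∃ a next, P.instr l = .asgn a next ∧ a.target = v

/-! ### The restricted class -/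

namespace Block

/-- The integer and real variables to which some statement of the block assigns. -/
def numAssigned : Block σ → Set (Var σ)
  | nil => ∅
  | asgn _ a rest => {v | v = a.target ∧ v.IsNumeric} ∪ rest.numAssigned
  | exit _ rest => rest.numAssigned
  | ite _ _ p q rest => p.numAssigned ∪ q.numAssigned ∪ rest.numAssigned
  | .while _ _ body rest => body.numAssigned ∪ rest.numAssigned

/-- No integer or real variable is assigned within the scope of a `while`. -/
def BoundedAssignments : Block σ → Prop
  | nil => True
  | asgn _ _ rest => rest.BoundedAssignments
  | exit _ rest => rest.BoundedAssignments
  | ite _ _ p q rest => p.BoundedAssignments ∧ q.BoundedAssignments ∧ rest.BoundedAssignments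
  | .while _ _ body rest => body.numAssigned = ∅ ∧ rest.BoundedAssignments

/-- No two assignments to the same integer or real variable, except that the two branches of an
`if` may assign to the same variable (only one of them is executed). -/
def SingleAssignment : Block σ → Prop
  | nil => True
  | asgn _ a rest => (a.target.IsNumeric → a.target ∉ rest.numAssigned) ∧ rest.SingleAssignment
  | exit _ rest => rest.SingleAssignment
  | ite _ _ p q rest => p.SingleAssignment ∧ q.SingleAssignment ∧ rest.SingleAssignment ∧
      Disjoint (p.numAssigned ∪ q.numAssigned) rest.numAssigned
  | .while _ _ body rest => body.SingleAssignment ∧ rest.SingleAssignment ∧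
      Disjoint body.numAssigned rest.numAssigned

end Block

/-- The restricted class of programs: labels are unique, integer and real variables are not
assigned in the scope of a `while`, and they are assigned at most once. -/
structure Program.IsDiPWhile (P : Program σ) : Prop where
  labels_unique : (P.last :: P.body.labels).Nodup
  bounded : P.body.BoundedAssignments
  single : P.body.SingleAssignment

/-! ### Evaluation of expressions -/

def DExp.eval (hX : σ.XVar → σ.Dom) : DExp σ → σ.Dom
  | const d => d
  | var x => hX x
  | app f args => f fun i => (args i).eval hX

def BExp.eval (hB : σ.BVar → Bool) (hX : σ.XVar → σ.Dom) : BExp σ → Bool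
  | tt => true
  | ff => false
  | var b => hB b
  | not e => !(e.eval hB hX)
  | and e₁ e₂ => e₁.eval hB hX && e₂.eval hB hX
  | or e₁ e₂ => e₁.eval hB hX || e₂.eval hB hX
  | app g args => g fun i => (args i).eval hX

def IExp.eval (hX : σ.XVar → σ.Dom) (hZ : σ.ZVar → ℤ) : IExp σ → ℤ
  | var z => hZ z
  | constMul i e => i * e.eval hX hZ
  | domMul d e => (d.eval hX : ℤ) * e.eval hX hZ
  | add e₁ e₂ => e₁.eval hX hZ + e₂.eval hX hZ
  | addConst e i => e.eval hX hZ + i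
  | addDom e d => e.eval hX hZ + (d.eval hX : ℤ)

def RExp.eval (hX : σ.XVar → σ.Dom) (hR : σ.RVar → ℝ) : RExp σ → ℝ
  | var r => hR r
  | constMul q e => (q : ℝ) * e.eval hX hR
  | domMul d e => ((d.eval hX : ℤ) : ℝ) * e.eval hX hR
  | add e₁ e₂ => e₁.eval hX hR + e₂.eval hX hR
  | addConst e q => e.eval hX hR + (q : ℝ)
  | addDom e d => e.eval hX hR + ((d.eval hX : ℤ) : ℝ)

def Rel.Holds {α : Type} [LinearOrder α] : Rel → α → α → Prop
  | lt, x, y => x < y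
  | gt, x, y => x > y
  | eq, x, y => x = y
  | le, x, y => x ≤ y
  | ge, x, y => x ≥ y

def CExp.Holds (hX : σ.XVar → σ.Dom) (hZ : σ.ZVar → ℤ) (hR : σ.RVar → ℝ) : CExp σ → Prop
  | intInt rel e₁ e₂ => rel.Holds (e₁.eval hX hZ) (e₂.eval hX hZ)
  | intDom rel e d => rel.Holds (e.eval hX hZ) (d.eval hX : ℤ)
  | realReal rel e₁ e₂ => rel.Holds (e₁.eval hX hR) (e₂.eval hX hR)
  | realDom rel e d => rel.Holds (e.eval hX hR) ((d.eval hX : ℤ) : ℝ)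

open Classical in
/-- The truth value of a comparison. -/
def CExp.eval (hX : σ.XVar → σ.Dom) (hZ : σ.ZVar → ℤ) (hR : σ.RVar → ℝ) (c : CExp σ) : Bool :=
  decide (c.Holds hX hZ hR)

/-- Input valuations. -/
abbrev Program.InVal (P : Program σ) : Type := P.inputs → σ.Dom

/-- Output valuations. -/
abbrev Program.OutVal (P : Program σ) : Type := P.outputs → σ.Dom

/-! ### Markov kernel semantics -/

/-- Discrete states: a label and values of the Boolean, `DOM` and integer variables. -/
abbrev DiscState (σ : Sig) : Type :=
  σ.Label × (σ.BVar → Bool) × (σ.XVar → σ.Dom) × (σ.ZVar → ℤ)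

/-- States `((l, hB, hX, hZ), hR)`, with the product σ-algebra (discrete on the first component,
Borel on the values of the real variables). -/
abbrev NState (σ : Sig) : Type := DiscState σ × (σ.RVar → ℝ)

/-- The label of the statement to be executed next. -/
def NState.label (s : NState σ) : σ.Label := s.1.1

/-- The values of the `DOM` variables. -/
def NState.domVal (s : NState σ) : σ.XVar → σ.Dom := s.1.2.2.1

/-- The distribution of the next state when an assignment is executed, where `n` is the label of
the next statement. -/
def Asgn.natStep (ε : PosReal) (n : σ.Label) : Asgn σ → NState σ → Measure (NState σ)
  | dom x e, ((_, hB, hX, hZ), hR) =>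
      Measure.dirac ((n, hB, Function.update hX x (e.eval hX), hZ), hR)
  | expo x a F xs e, ((_, hB, hX, hZ), hR) =>
      ((expMech (scale a ε) (F (fun i => hX (xs i)) (e.eval hX))).toMeasure).map
        fun d => ((n, hB, Function.update hX x d, hZ), hR)
  | choose x a D es, ((_, hB, hX, hZ), hR) =>
      ((D (scale a ε) fun i => (es i).eval hX).toMeasure).map
        fun d => ((n, hB, Function.update hX x d, hZ), hR)
  | int z e, ((_, hB, hX, hZ), hR) =>
      Measure.dirac ((n, hB, hX, Function.update hZ z (e.eval hX hZ)), hR)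
  | dLap z a e, ((_, hB, hX, hZ), hR) =>
      ((DP.dLap (scale a ε) (e.eval hX : ℤ)).toMeasure).map
        fun i => ((n, hB, hX, Function.update hZ z i), hR)
  | real r e, ((_, hB, hX, hZ), hR) =>
      Measure.dirac ((n, hB, hX, hZ), Function.update hR r (e.eval hX hR))
  | lap r a e, ((_, hB, hX, hZ), hR) =>
      (DP.lap (scale a ε) ((e.eval hX : ℤ) : ℝ)).map
        fun y => ((n, hB, hX, hZ), Function.update hR r y)
  | bool b e, ((_, hB, hX, hZ), hR) =>
      Measure.dirac ((n, Function.update hB b (e.eval hB hX), hX, hZ), hR)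
  | cmp b c, ((_, hB, hX, hZ), hR) =>
      Measure.dirac ((n, Function.update hB b (c.eval hX hZ hR), hX, hZ), hR)

/-- The distribution of the next state. -/
def Program.natStep (P : Program σ) (ε : PosReal) (s : NState σ) : Measure (NState σ) :=
  match P.instr s.1.1 with
  | .exit => Measure.dirac s
  | .asgn a n => a.natStep ε n s
  | .branch c l₁ l₂ =>
      Measure.dirac ((if c.eval s.1.2.1 s.1.2.2.1 then l₁ else l₂, s.1.2), s.2)

theorem RExp.measurable_eval (hX : σ.XVar → σ.Dom) (e : RExp σ) :
    Measurable fun hR : σ.RVar → ℝ => e.eval hX hR := by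
  induction e with
  | var r => exact measurable_pi_apply r
  | constMul q e ih => exact ih.const_mul _
  | domMul d e ih => exact ih.const_mul _
  | add e₁ e₂ ih₁ ih₂ => exact ih₁.add ih₂
  | addConst e q ih => exact ih.add_const _
  | addDom e d ih => exact ih.add_const _

theorem Rel.measurableSet_holds {α : Type} [MeasurableSpace α] (rel : Rel) {f g : α → ℝ}
    (hf : Measurable f) (hg : Measurable g) : MeasurableSet {x | rel.Holds (f x) (g x)} := by
  cases rel with
  | lt => exact measurableSet_lt hf hg
  | gt => exact measurableSet_lt hg hf
  | eq => exact measurableSet_eq_fun hf hg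
  | le => exact measurableSet_le hf hg
  | ge => exact measurableSet_le hg hf

theorem CExp.measurableSet_holds (hX : σ.XVar → σ.Dom) (hZ : σ.ZVar → ℤ) (c : CExp σ) :
    MeasurableSet {hR : σ.RVar → ℝ | c.Holds hX hZ hR} := by
  cases c with
  | intInt rel e₁ e₂ => exact MeasurableSet.const _
  | intDom rel e d => exact MeasurableSet.const _
  | realReal rel e₁ e₂ =>
      exact rel.measurableSet_holds (e₁.measurable_eval hX) (e₂.measurable_eval hX)
  | realDom rel e d => exact rel.measurableSet_holds (e.measurable_eval hX) measurable_const

theorem CExp.measurable_eval (hX : σ.XVar → σ.Dom) (hZ : σ.ZVar → ℤ) (c : CExp σ) :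
    Measurable fun hR : σ.RVar → ℝ => c.eval hX hZ hR := by
  classical
  refine measurable_to_bool ?_
  convert c.measurableSet_holds hX hZ using 1
  ext hR
  simp [CExp.eval]

theorem measurable_map_update (μ : Measure ℝ) [IsProbabilityMeasure μ] (r : σ.RVar)
    (ds : DiscState σ) :
    Measurable fun hR : σ.RVar → ℝ =>
      μ.map fun y => ((ds, Function.update hR r y) : NState σ) := by
  have hm : Measurable fun p : (σ.RVar → ℝ) × ℝ => ((ds, Function.update p.1 r p.2) : NState σ) :=
    measurable_const.prodMk <| measurable_pi_lambda _ fun i => by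
      by_cases h : i = r
      · subst h
        simpa using measurable_snd
      · simp only [Function.update_of_ne h]
        exact (measurable_pi_apply i).comp measurable_fst
  refine Measure.measurable_of_measurable_coe _ fun s hs => ?_
  have h1 : ∀ hR : σ.RVar → ℝ,
      (μ.map fun y => ((ds, Function.update hR r y) : NState σ)) s
        = μ (Prod.mk hR ⁻¹' ((fun p : (σ.RVar → ℝ) × ℝ =>
            ((ds, Function.update p.1 r p.2) : NState σ)) ⁻¹' s)) := fun hR => by
    exact Measure.map_apply (hm.comp (measurable_prodMk_left (x := hR))) hs
  simp only [h1]
  exact measurable_measure_prodMk_left (hm hs)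

theorem measurable_map_discrete {α : Type} [MeasurableSpace α] [DiscreteMeasurableSpace α]
    (μ : Measure α) [IsProbabilityMeasure μ] (f : α → DiscState σ) :
    Measurable fun hR : σ.RVar → ℝ => μ.map fun d => ((f d, hR) : NState σ) := by
  refine Measure.measurable_of_measurable_coe _ fun s hs => ?_
  have hm : Measurable fun p : (σ.RVar → ℝ) × α => ((f p.2, p.1) : NState σ) :=
    (((Measurable.of_discrete : Measurable f)).comp measurable_snd).prodMk measurable_fst
  have h1 : ∀ hR : σ.RVar → ℝ,
      (μ.map fun d => ((f d, hR) : NState σ)) s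
        = μ (Prod.mk hR ⁻¹' ((fun p : (σ.RVar → ℝ) × α => ((f p.2, p.1) : NState σ)) ⁻¹' s)) :=
    fun hR => by
      exact Measure.map_apply (hm.comp (measurable_prodMk_left (x := hR))) hs
  simp only [h1]
  exact measurable_measure_prodMk_left (hm hs)

theorem Asgn.measurable_natStep (ε : PosReal) (n : σ.Label) (a : Asgn σ) (ds : DiscState σ) :
    Measurable fun hR : σ.RVar → ℝ => a.natStep ε n (ds, hR) := by
  obtain ⟨l, hB, hX, hZ⟩ := ds
  cases a with
  | dom x e => exact Measure.measurable_dirac.comp measurable_prodMk_left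
  | expo x a F xs e => exact measurable_map_discrete _ _
  | choose x a D es => exact measurable_map_discrete _ _
  | int z e => exact Measure.measurable_dirac.comp measurable_prodMk_left
  | dLap z a e => exact measurable_map_discrete _ _
  | real r e =>
      refine Measure.measurable_dirac.comp (measurable_const.prodMk ?_)
      refine measurable_pi_lambda _ fun i => ?_
      by_cases h : i = r
      · subst h
        simpa using e.measurable_eval hX
      · simpa only [Function.update_of_ne h] using measurable_pi_apply i
  | lap r a e => exact measurable_map_update _ _ _
  | bool b e => exact Measure.measurable_dirac.comp measurable_prodMk_left
  | cmp b c =>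
      refine Measure.measurable_dirac.comp (Measurable.prodMk ?_ measurable_id)
      exact (Measurable.of_discrete (f := fun t : Bool =>
        ((n, Function.update hB b t, hX, hZ) : DiscState σ))).comp (c.measurable_eval hX hZ)

theorem Program.measurable_natStep (P : Program σ) (ε : PosReal) : Measurable (P.natStep ε) := by
  refine measurable_from_prod_countable_right fun ds => ?_
  unfold Program.natStep
  rcases h : P.instr ds.1 with _ | ⟨a, n⟩ | ⟨c, l₁, l₂⟩
  · simp only [h]
    exact Measure.measurable_dirac.comp measurable_prodMk_left
  · simp only [h]
    exact a.measurable_natStep ε n ds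
  · simp only [h]
    refine Measure.measurable_dirac.comp ?_
    exact measurable_prodMk_left
      (x := ((if c.eval ds.2.1 ds.2.2.1 then l₁ else l₂, ds.2) : DiscState σ))

/-- The Markov kernel of a program. -/
def Program.kernel (P : Program σ) (ε : PosReal) : Kernel (NState σ) (NState σ) :=
  ⟨P.natStep ε, P.measurable_natStep ε⟩

instance (P : Program σ) (ε : PosReal) : IsMarkovKernel (P.kernel ε) := by
  refine ⟨fun s => ?_⟩
  obtain ⟨⟨l, hB, hX, hZ⟩, hR⟩ := s
  change IsProbabilityMeasure (P.natStep ε _)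
  unfold Program.natStep
  rcases h : P.instr l with _ | ⟨a, n⟩ | ⟨c, l₁, l₂⟩
  · infer_instance
  · cases a with
    | dom x e => exact Measure.dirac.isProbabilityMeasure
    | expo x a F xs e =>
        exact Measure.isProbabilityMeasure_map Measurable.of_discrete.aemeasurable
    | choose x a D es =>
        exact Measure.isProbabilityMeasure_map Measurable.of_discrete.aemeasurable
    | int z e => exact Measure.dirac.isProbabilityMeasure
    | dLap z a e =>
        exact Measure.isProbabilityMeasure_map Measurable.of_discrete.aemeasurable
    | real r e => exact Measure.dirac.isProbabilityMeasure
    | lap r a e =>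
        exact Measure.isProbabilityMeasure_map
          (measurable_const.prodMk (measurable_update hR)).aemeasurable
    | bool b e => exact Measure.dirac.isProbabilityMeasure
    | cmp b c => exact Measure.dirac.isProbabilityMeasure
  · infer_instance

open Classical in
/-- The initial state: input variables have the given values, all other variables are `false`
or `0`. -/
def Program.natInit (P : Program σ) (inp : P.InVal) : NState σ :=
  ((P.start, fun _ => false, fun x => if h : x ∈ P.inputs then inp ⟨x, h⟩ else 0, fun _ => 0),
    fun _ => 0)

/-- The law of the executions of length `i + 1`: the first state is the initial state, and each
further state is drawn from the Markov kernel at the state before it. -/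
def Program.execLaw (P : Program σ) (ε : PosReal) (inp : P.InVal) :
    (i : ℕ) → Measure (Fin (i + 1) → NState σ)
  | 0 => Measure.dirac fun _ => P.natInit inp
  | i + 1 =>
      (P.execLaw ε inp i ⊗ₘ
        (P.kernel ε).comap (fun α => α (Fin.last i)) (measurable_pi_apply (Fin.last i))).map
          fun p => Fin.snoc (α := fun _ => NState σ) p.1 p.2

/-- The label `l` is the label of an `exit` statement. -/
def Program.IsExit (P : Program σ) (l : σ.Label) : Prop := P.instr l = .exit

/-- The executions of length `i + 1` that terminate at their last state and not before, with
output `out`. -/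
def Program.required (P : Program σ) (out : P.OutVal) (i : ℕ) : Set (Fin (i + 1) → NState σ) :=
  {α | P.IsExit (α (Fin.last i)).label ∧ (∀ x : P.outputs, (α (Fin.last i)).domVal x = out x) ∧
    ∀ j : Fin i, ¬ P.IsExit (α j.castSucc).label}

/-- The probability of the output `out` on the input `inp` in the Markov kernel semantics. -/
def Program.probNatural (P : Program σ) (ε : PosReal) (inp : P.InVal) (out : P.OutVal) : ℝ≥0∞ :=
  ∑' i : ℕ, P.execLaw ε inp i (P.required out i)

/-- In the execution `α`, every variable is an input variable or has been assigned before it is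
referred to. -/
def Program.RefersToAssigned (P : Program σ) {i : ℕ} (α : Fin (i + 1) → NState σ) : Prop :=
  ∀ j, ∀ v ∈ P.readsAt (α j).label,
    (∃ x ∈ P.inputs, v = .dom x) ∨ ∃ k < j, P.AssignsAt (α k).label v

/-- Variables are assigned before they are referred to, in (almost) every execution on the input
`inp` with the parameter value `ε`. -/
def Program.AssignedBeforeUse (P : Program σ) (ε : PosReal) (inp : P.InVal) : Prop :=
  ∀ i, ∀ᵐ α ∂(P.execLaw ε inp i), P.RefersToAssigned α

/-! ### DTMC semantics -/

/-- Partial evaluation: `DOM` subexpressions are replaced by their values. -/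
def IExp.peval (val : σ.XVar → σ.Dom) : IExp σ → IExp σ
  | var z => var z
  | constMul i e => constMul i (e.peval val)
  | domMul d e => domMul (.const (d.eval val)) (e.peval val)
  | add e₁ e₂ => add (e₁.peval val) (e₂.peval val)
  | addConst e i => addConst (e.peval val) i
  | addDom e d => addDom (e.peval val) (.const (d.eval val))

/-- Partial evaluation: `DOM` subexpressions are replaced by their values. -/
def RExp.peval (val : σ.XVar → σ.Dom) : RExp σ → RExp σ
  | var r => var r
  | constMul q e => constMul q (e.peval val)
  | domMul d e => domMul (.const (d.eval val)) (e.peval val)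
  | add e₁ e₂ => add (e₁.peval val) (e₂.peval val)
  | addConst e q => addConst (e.peval val) q
  | addDom e d => addDom (e.peval val) (.const (d.eval val))

/-- Partial evaluation: `DOM` subexpressions are replaced by their values. -/
def CExp.peval (val : σ.XVar → σ.Dom) : CExp σ → CExp σ
  | intInt rel e₁ e₂ => intInt rel (e₁.peval val) (e₂.peval val)
  | intDom rel e d => intDom rel (e.peval val) (.const (d.eval val))
  | realReal rel e₁ e₂ => realReal rel (e₁.peval val) (e₂.peval val)
  | realDom rel e d => realDom rel (e.peval val) (.const (d.eval val))

namespace Program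

/-- The partially evaluated integer expressions on the right-hand side of assignments. -/
def zExp (P : Program σ) : Set (IExp σ) :=
  {e' | ∃ l z e n val, P.instr l = .asgn (.int z e) n ∧ e' = e.peval val}

/-- The partially evaluated real expressions on the right-hand side of assignments. -/
def rExp (P : Program σ) : Set (RExp σ) :=
  {e' | ∃ l r e n val, P.instr l = .asgn (.real r e) n ∧ e' = e.peval val}

/-- The partially evaluated comparisons on the right-hand side of assignments. -/
def bExp (P : Program σ) : Set (CExp σ) :=
  {c' | ∃ l b c n val, P.instr l = .asgn (.cmp b c) n ∧ c' = c.peval val}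

/-- The coefficients of `ε` in the Laplace and discrete Laplace assignments. -/
def coeffs (P : Program σ) : Set PosRat :=
  {a | (∃ l z e n, P.instr l = .asgn (.dLap z a e) n) ∨
    ∃ l r e n, P.instr l = .asgn (.lap r a e) n}

end Program

/-- States of the DTMC semantics. The partial functions `fZ` and `fR` map a variable to the
expression assigned to it or to the parameters `(a, d)` of the distribution `DLap(a ε, d)` or
`Lap(a ε, d)` from which it was sampled. An element `(true, c)` of `conds` is the condition `c`,
and `(false, c)` is its negation. -/
@[ext]
structure DState (P : Program σ) where
  label : σ.Label
  fB : σ.BVar → Option Bool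
  fX : σ.XVar → Option σ.Dom
  fZ : σ.ZVar → Option (P.zExp ⊕ (P.coeffs × σ.Dom))
  fR : σ.RVar → Option (P.rExp ⊕ (P.coeffs × σ.Dom))
  conds : Set (Bool × P.bExp)

namespace Program

variable (P : Program σ)

theorem finite_zExp : P.zExp.Finite := by
  refine ((Set.finite_range fun p : σ.Label × (σ.XVar → σ.Dom) =>
    match P.instr p.1 with
    | .asgn (.int _ e) _ => some (e.peval p.2)
    | _ => none).preimage (Option.some_injective _).injOn).subset ?_
  rintro _ ⟨l, z, e, n, val, h, rfl⟩
  exact ⟨(l, val), by simp only [h]⟩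

theorem finite_rExp : P.rExp.Finite := by
  refine ((Set.finite_range fun p : σ.Label × (σ.XVar → σ.Dom) =>
    match P.instr p.1 with
    | .asgn (.real _ e) _ => some (e.peval p.2)
    | _ => none).preimage (Option.some_injective _).injOn).subset ?_
  rintro _ ⟨l, z, e, n, val, h, rfl⟩
  exact ⟨(l, val), by simp only [h]⟩

theorem finite_bExp : P.bExp.Finite := by
  refine ((Set.finite_range fun p : σ.Label × (σ.XVar → σ.Dom) =>
    match P.instr p.1 with
    | .asgn (.cmp _ c) _ => some (c.peval p.2)
    | _ => none).preimage (Option.some_injective _).injOn).subset ?_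
  rintro _ ⟨l, z, e, n, val, h, rfl⟩
  exact ⟨(l, val), by simp only [h]⟩

theorem finite_coeffs : P.coeffs.Finite := by
  refine ((Set.finite_range fun l : σ.Label =>
    match P.instr l with
    | .asgn (.dLap _ a _) _ => some a
    | .asgn (.lap _ a _) _ => some a
    | _ => none).preimage (Option.some_injective _).injOn).subset ?_
  rintro _ (⟨l, z, e, n, h⟩ | ⟨l, z, e, n, h⟩)
  · exact ⟨l, by simp only [h]⟩
  · exact ⟨l, by simp only [h]⟩

/-- The DTMC semantics has finitely many states. -/
instance : Finite (DState P) := by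
  have := P.finite_zExp.to_subtype
  have := P.finite_rExp.to_subtype
  have := P.finite_bExp.to_subtype
  have := P.finite_coeffs.to_subtype
  refine Finite.of_injective (fun z : DState P => (z.label, z.fB, z.fX, z.fZ, z.fR, z.conds)) ?_
  intro z z' h
  simp only [Prod.mk.injEq] at h
  obtain ⟨h1, h2, h3, h4, h5, h6⟩ := h
  exact DState.ext h1 h2 h3 h4 h5 h6

end Program

namespace DState

variable {P : Program σ}

/-- The values of the Boolean variables; `false` if undefined. -/
def boolVal (z : DState P) : σ.BVar → Bool := fun b => (z.fB b).getD false

/-- The values of the `DOM` variables; `0` if undefined. -/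
def domVal (z : DState P) : σ.XVar → σ.Dom := fun x => (z.fX x).getD 0

/-- The joint law of independent samples for the sampled integer and real variables, with the
parameters that the state records (and `0` for the other variables). -/
def noise (z : DState P) (ε : PosReal) : Measure ((σ.ZVar → ℤ) × (σ.RVar → ℝ)) :=
  (Measure.pi fun x => match z.fZ x with
    | some (.inr (a, d)) => (DP.dLap (scale a ε) (d : ℤ)).toMeasure
    | _ => Measure.dirac 0).prod
  (Measure.pi fun x => match z.fR x with
    | some (.inr (a, d)) => DP.lap (scale a ε) ((d : ℤ) : ℝ)
    | _ => Measure.dirac 0)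

/-- The values `v` of the integer and real variables are those determined by the samples `ω` and
the recorded assignments of expressions. -/
def Determines (z : DState P) (ω v : (σ.ZVar → ℤ) × (σ.RVar → ℝ)) : Prop :=
  (∀ x, match z.fZ x with
    | some (.inl e) => v.1 x = e.1.eval (fun _ => 0) v.1
    | _ => v.1 x = ω.1 x) ∧
  ∀ x, match z.fR x with
    | some (.inl e) => v.2 x = e.1.eval (fun _ => 0) v.2
    | _ => v.2 x = ω.2 x

/-- The event that all conditions in `C` hold. -/
def event (z : DState P) (C : Set (Bool × P.bExp)) : Set ((σ.ZVar → ℤ) × (σ.RVar → ℝ)) :=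
  {ω | ∃ v, z.Determines ω v ∧ ∀ c ∈ C, c.2.1.eval (fun _ => 0) v.1 v.2 = c.1}

open Classical in
/-- The conditional probability that `c` holds given that all conditions of the state hold; `0` if
the latter have probability `0`. -/
def condProb (z : DState P) (ε : PosReal) (c : P.bExp) : ℝ≥0∞ :=
  if z.noise ε (z.event z.conds) = 0 then 0
  else z.noise ε (z.event (insert (true, c) z.conds)) / z.noise ε (z.event z.conds)

theorem condProb_le_one (z : DState P) (ε : PosReal) (c : P.bExp) : z.condProb ε c ≤ 1 := by
  unfold condProb
  split_ifs with h
  · exact zero_le_one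
  · refine ENNReal.div_le_of_le_mul ?_
    rw [one_mul]
    refine measure_mono ?_
    rintro ω ⟨v, hv, hC⟩
    exact ⟨v, hv, fun c' hc' => hC c' (Set.mem_insert_of_mem _ hc')⟩

/-- The distribution of the next state. -/
def step (z : DState P) (ε : PosReal) : PMF (DState P) :=
  match h : P.instr z.label with
  | .exit => PMF.pure z
  | .branch c l₁ l₂ =>
      PMF.pure { z with label := if c.eval z.boolVal z.domVal then l₁ else l₂ }
  | .asgn (.dom x e) n =>
      PMF.pure { z with label := n, fX := Function.update z.fX x (some (e.eval z.domVal)) }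
  | .asgn (.expo x a F xs e) n =>
      (expMech (scale a ε) (F (fun i => z.domVal (xs i)) (e.eval z.domVal))).map fun d =>
        { z with label := n, fX := Function.update z.fX x (some d) }
  | .asgn (.choose x a D es) n =>
      (D (scale a ε) fun i => (es i).eval z.domVal).map fun d =>
        { z with label := n, fX := Function.update z.fX x (some d) }
  | .asgn (.int x e) n =>
      PMF.pure { z with
        label := n
        fZ := Function.update z.fZ x
          (some (.inl ⟨e.peval z.domVal, z.label, x, e, n, z.domVal, h, rfl⟩)) }
  | .asgn (.dLap x a e) n =>
      PMF.pure { z with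
        label := n
        fZ := Function.update z.fZ x
          (some (.inr (⟨a, Or.inl ⟨z.label, x, e, n, h⟩⟩, e.eval z.domVal))) }
  | .asgn (.real x e) n =>
      PMF.pure { z with
        label := n
        fR := Function.update z.fR x
          (some (.inl ⟨e.peval z.domVal, z.label, x, e, n, z.domVal, h, rfl⟩)) }
  | .asgn (.lap x a e) n =>
      PMF.pure { z with
        label := n
        fR := Function.update z.fR x
          (some (.inr (⟨a, Or.inr ⟨z.label, x, e, n, h⟩⟩, e.eval z.domVal))) }
  | .asgn (.bool b e) n =>
      PMF.pure { z with
        label := n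
        fB := Function.update z.fB b (some (e.eval z.boolVal z.domVal)) }
  | .asgn (.cmp b c) n =>
      let c' : P.bExp := ⟨c.peval z.domVal, z.label, b, c, n, z.domVal, h, rfl⟩
      (coin (z.condProb ε c') (z.condProb_le_one ε c')).map fun t =>
        { z with
          label := n
          fB := Function.update z.fB b (some t)
          conds := insert (t, c') z.conds }

end DState

namespace Program

/-- The DTMC semantics of a program. -/
def dtmc (P : Program σ) : ParamDTMC where
  State := DState P
  countable := Finite.to_countable
  trans := DState.step

open Classical in
/-- The initial state: only the input variables are defined, and there are no conditions. -/
def dtmcInit (P : Program σ) (inp : P.InVal) : DState P where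
  label := P.start
  fB := fun _ => none
  fX := fun x => if h : x ∈ P.inputs then some (inp ⟨x, h⟩) else none
  fZ := fun _ => none
  fR := fun _ => none
  conds := ∅

/-- The exit states with output `out`. -/
def dtmcTarget (P : Program σ) (out : P.OutVal) : Set (DState P) :=
  {z | P.IsExit z.label ∧ ∀ x : P.outputs, z.fX x = some (out x)}

/-- The probability of the output `out` on the input `inp` in the DTMC semantics. -/
def probDTMC (P : Program σ) (ε : PosReal) (inp : P.InVal) (out : P.OutVal) : ℝ≥0∞ :=
  P.dtmc.reachProb (P.dtmcInit inp) (P.dtmcTarget out) ε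

end Program

end

end DP

namespace DP

noncomputable section

variable {σ : Sig}

/-! A state `z` of the DTMC stands for a conditional law on kernel states. Draw independent noise
with the recorded parameters, solve the recorded equations for the integer and real values
(`DState.solve`), and condition the resulting law (`DState.valueLaw`) on the recorded comparisons.
Together with the label and the finite valuations of `z`, this is a distribution on kernel states,
against which `DState.expect` integrates.

The invariant, `Program.Correspondence`, is a mixture formula: at each time, the law of the kernel
chain on the executions that have not passed an `exit` is the mixture of these conditional laws,
weighted by the probability `Program.visitProb` that the DTMC is in `z` at that time. Integrating
the indicator of termination with the given output and summing over time gives the theorem.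

The formula is propagated by `DState.simulates`: one kernel step from the conditional law of `z`
yields the mixture of the conditional laws of the successors of `z`. For a `DOM` sampling both sides
branch in the same way. For a Laplace sampling the DTMC does not branch, and one independent
coordinate joins the noise (`map_update_prod_pi`). For an integer or real assignment one equation is
added. For a comparison the step is the law of total probability (`simulates_cmp`): `p` and `1 - p`
are the weights that split the law given `C` into the laws given `C ∪ {c}` and `C ∪ {¬c}`.

All this needs an assigned integer or real variable to be fresh, since overwriting a value would
change the meaning of expressions and conditions recorded earlier. Freshness comes from the
restricted class: `Program.future`, the variables that may still be assigned, shrinks along the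
control flow and loses each numeric variable as it is assigned. It is kept disjoint from the
variables that have a value, while recorded expressions and conditions mention only the latter,
because variables are assigned before use. That hypothesis concerns kernel executions; it is
transferred to DTMC states by the mixture formula itself (`Correspondence.readsAt_subset`), which
for this purpose also tracks the set of assigned variables. -/

/-! ### Control flow of integer and real assignments -/

/-- The labels of the statements that may be executed next. -/
def Instr.succs : Instr σ → Set σ.Label
  | .exit => ∅
  | .asgn _ n => {n}
  | .branch _ l₁ l₂ => {l₁, l₂}

/-- The integer or real variable that is assigned, if any. -/
def Instr.numTarget : Instr σ → Set (Var σ)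
  | .exit => ∅
  | .asgn a _ => {v | v = a.target ∧ v.IsNumeric}
  | .branch _ _ _ => ∅

namespace Block

open Classical in
/-- An upper bound on the integer and real variables that may be assigned when the execution is
continued from the label `query`. -/
def future : Block σ → (query : σ.Label) → Set (Var σ)
  -- Labels outside the block end up in this case. When labels are unique this includes the label
  -- that follows the block; an enclosing block accounts for what is executed from there on.
  | nil, _ => ∅
  | asgn l a rest, query =>
      if query = l then {v | v = a.target ∧ v.IsNumeric} ∪ rest.numAssigned else rest.future query
  | exit l rest, query => if query = l then ∅ else rest.future query
  | ite l _ p q rest, query =>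
      if query = l then p.numAssigned ∪ q.numAssigned ∪ rest.numAssigned
      else if query ∈ p.labels then p.future query ∪ rest.numAssigned
      else if query ∈ q.labels then q.future query ∪ rest.numAssigned
      else rest.future query
  | .while l _ body rest, query =>
      -- The body contributes nothing: in the restricted class it assigns no integer or real
      -- variable. The set is therefore constant around the loop, and the back edge does not enlarge
      -- it.
      if query = l ∨ query ∈ body.labels then rest.numAssigned else rest.future query

theorem entry_mem (B : Block σ) (follow : σ.Label) :
    B.entry follow = follow ∨ B.entry follow ∈ B.labels := by
  cases B <;> simp [entry, labels]

theorem future_subset (B : Block σ) (q : σ.Label) : B.future q ⊆ B.numAssigned := by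
  induction B with
  | nil => simp [future]
  | asgn l a rest ih =>
    simp only [future, numAssigned]
    split_ifs
    · exact subset_rfl
    · exact ih.trans Set.subset_union_right
  | exit l rest ih =>
    simp only [future, numAssigned]
    split_ifs
    · exact Set.empty_subset _
    · exact ih
  | ite l c p q rest ihp ihq ih =>
    simp only [future, numAssigned]
    split_ifs
    · exact subset_rfl
    · exact Set.union_subset_union_left _ (ihp.trans Set.subset_union_left)
    · exact Set.union_subset_union_left _ (ihq.trans Set.subset_union_right)
    · exact ih.trans Set.subset_union_right
  | _ =>
    rename_i l c body rest ihb ih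
    simp only [future, numAssigned]
    split_ifs
    · exact Set.subset_union_right
    · exact ih.trans Set.subset_union_right

/-- Control leaves a block only through `follow`. Hence, when a sub-block is analysed in
`future_succ`, a single label outside it has to be considered. -/
theorem instrAt_spec (B : Block σ) (follow q : σ.Label) (i : Instr σ)
    (h : B.instrAt follow q = some i) :
    q ∈ B.labels ∧ i.numTarget ⊆ B.numAssigned ∧ ∀ s ∈ i.succs, s = follow ∨ s ∈ B.labels := by
  induction B generalizing follow with
  | nil => simp [instrAt] at h
  | asgn l a rest ih =>
    simp only [instrAt] at h
    simp only [labels, numAssigned, List.mem_cons]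
    split_ifs at h with hq
    · obtain rfl := Option.some.inj h
      refine ⟨.inl hq, Set.subset_union_left, ?_⟩
      rintro s rfl
      rcases rest.entry_mem follow with h | h
      · exact .inl h
      · exact .inr (.inr h)
    · obtain ⟨h1, h2, h3⟩ := ih _ h
      exact ⟨.inr h1, h2.trans Set.subset_union_right, fun s hs => (h3 s hs).imp_right .inr⟩
  | exit l rest ih =>
    simp only [instrAt] at h
    simp only [labels, numAssigned, List.mem_cons]
    split_ifs at h with hq
    · obtain rfl := Option.some.inj h
      exact ⟨.inl hq, by simp [Instr.numTarget], by simp [Instr.succs]⟩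
    · obtain ⟨h1, h2, h3⟩ := ih _ h
      exact ⟨.inr h1, h2, fun s hs => (h3 s hs).imp_right .inr⟩
  | ite l c p q rest ihp ihq ih =>
    simp only [instrAt] at h
    simp only [labels, numAssigned, List.mem_cons, List.mem_append]
    have he := rest.entry_mem follow
    split_ifs at h with hq
    · obtain rfl := Option.some.inj h
      refine ⟨.inl hq, by simp [Instr.numTarget], ?_⟩
      rintro s (rfl | rfl)
      · have := p.entry_mem (rest.entry follow)
        grind
      · have := q.entry_mem (rest.entry follow)
        grind
    · simp only [Option.or_eq_some_iff] at h
      rcases h with (h | ⟨-, h⟩) | ⟨-, h⟩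
      · obtain ⟨h1, h2, h3⟩ := ihp _ h
        exact ⟨by tauto, fun v hv => .inl (.inl (h2 hv)), fun s hs => by grind⟩
      · obtain ⟨h1, h2, h3⟩ := ihq _ h
        exact ⟨by tauto, fun v hv => .inl (.inr (h2 hv)), fun s hs => by grind⟩
      · obtain ⟨h1, h2, h3⟩ := ih _ h
        exact ⟨by tauto, fun v hv => .inr (h2 hv), fun s hs => by grind⟩
  | _ =>
    rename_i l c body rest ihb ih
    simp only [instrAt] at h
    simp only [labels, numAssigned, List.mem_cons, List.mem_append]
    have he := rest.entry_mem follow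
    split_ifs at h with hq
    · obtain rfl := Option.some.inj h
      refine ⟨.inl hq, by simp [Instr.numTarget], ?_⟩
      rintro s (rfl | rfl)
      · have := body.entry_mem l
        grind
      · grind
    · simp only [Option.or_eq_some_iff] at h
      rcases h with h | ⟨-, h⟩
      · obtain ⟨h1, h2, h3⟩ := ihb _ h
        exact ⟨by tauto, fun v hv => .inl (h2 hv), fun s hs => by grind⟩
      · obtain ⟨h1, h2, h3⟩ := ih _ h
        exact ⟨by tauto, fun v hv => .inr (h2 hv), fun s hs => by grind⟩

/-- In a block of the restricted class, a variable is not assigned again after it is assigned. -/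
theorem future_succ (B : Block σ) (follow q : σ.Label) (i : Instr σ)
    (hl : (follow :: B.labels).Nodup) (hb : B.BoundedAssignments) (hs : B.SingleAssignment)
    (h : B.instrAt follow q = some i) :
    i.numTarget ⊆ B.future q ∧
      ∀ s ∈ i.succs, B.future s ⊆ B.future q ∧ Disjoint i.numTarget (B.future s) := by
  induction B generalizing follow with
  | nil => simp [instrAt] at h
  | asgn l a rest ih =>
    have hq' := fun h' => (rest.instrAt_spec follow q i h')
    simp only [instrAt] at h
    simp only [labels, List.nodup_cons, List.mem_cons, not_or] at hl
    have he := rest.entry_mem follow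
    split_ifs at h with hq
    · obtain rfl := Option.some.inj h
      refine ⟨by simp [future, hq, Instr.numTarget], ?_⟩
      rintro s rfl
      -- Including `follow` in the list of distinct labels excludes a jump back to `l`, even when
      -- `rest` is empty.
      have hne : rest.entry follow ≠ l := by grind
      simp only [future, hq, hne, if_true, if_false]
      refine ⟨(rest.future_subset _).trans Set.subset_union_right, ?_⟩
      refine Set.disjoint_of_subset_right (rest.future_subset _) ?_
      rw [Set.disjoint_left]
      rintro v ⟨rfl, hv⟩
      exact hs.1 hv
    · obtain ⟨h1, h2⟩ := ih follow (by simp [hl]) hb hs.2 h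
      refine ⟨by simpa [future, hq] using h1, fun s hsu => ?_⟩
      have hne : s ≠ l := by
        rcases (hq' h).2.2 s hsu with rfl | h' <;> grind
      simpa [future, hq, hne] using h2 s hsu
  | exit l rest ih =>
    have hq' := fun h' => (rest.instrAt_spec follow q i h')
    simp only [instrAt] at h
    simp only [labels, List.nodup_cons, List.mem_cons, not_or] at hl
    split_ifs at h with hq
    · obtain rfl := Option.some.inj h
      simp [Instr.numTarget, Instr.succs]
    · obtain ⟨h1, h2⟩ := ih follow (by simp [hl]) hb hs h
      refine ⟨by simpa [future, hq] using h1, fun s hsu => ?_⟩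
      have hne : s ≠ l := by
        rcases (hq' h).2.2 s hsu with rfl | h' <;> grind
      simpa [future, hq, hne] using h2 s hsu
  | ite l c p r rest ihp ihr ih =>
    obtain ⟨hbp, hbr, hb⟩ := hb
    obtain ⟨hsp, hsr, hs, hd⟩ := hs
    have hq' := fun h' => (ite l c p r rest).instrAt_spec follow q i h'
    replace hq' := hq' h
    simp only [labels, List.nodup_cons, List.nodup_append, List.mem_cons, List.mem_append,
      not_or] at hl
    obtain ⟨⟨hfl, ⟨hfp, hfr⟩, hfrest⟩, ⟨⟨hlp, hlr⟩, hlrest⟩, ⟨hnp, hnr, hpr⟩, hnrest, hprest⟩ := hl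
    have he := rest.entry_mem follow
    simp only [instrAt] at h
    split_ifs at h with hq
    · obtain rfl := Option.some.inj h
      refine ⟨by simp [Instr.numTarget], fun s hsu => ⟨?_, by simp [Instr.numTarget]⟩⟩
      have := future_subset (ite l c p r rest) s
      simpa [future, hq, numAssigned] using this
    · simp only [Option.or_eq_some_iff] at h
      rcases h with (h | ⟨-, h⟩) | ⟨-, h⟩
      · have hsp' := p.instrAt_spec _ _ _ h
        obtain ⟨h1, h2⟩ := ihp _ (by grind) hbp hsp h
        have hfq : (ite l c p r rest).future q = p.future q ∪ rest.numAssigned := by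
          simp [future, hq, hsp'.1]
        rw [hfq]
        refine ⟨h1.trans Set.subset_union_left, fun s hsu => ?_⟩
        -- A successor either is still in `p` or is the entry of what comes after the `if`, where
        -- the future lies in `rest.numAssigned`.
        have hsub : (ite l c p r rest).future s ⊆ p.future s ∪ rest.numAssigned := by
          rcases hsp'.2.2 s hsu with rfl | h'
          · have hn1 : rest.entry follow ≠ l := by grind
            have hn2 : rest.entry follow ∉ p.labels := by grind
            have hn3 : rest.entry follow ∉ r.labels := by grind
            simp only [future, hn1, hn2, hn3, if_false]
            exact (rest.future_subset _).trans Set.subset_union_right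
          · have hn1 : s ≠ l := by grind
            simp [future, hn1, h']
        refine ⟨hsub.trans (Set.union_subset_union_left _ (h2 s hsu).1), ?_⟩
        refine Set.disjoint_of_subset_right hsub (Set.disjoint_union_right.mpr ⟨(h2 s hsu).2, ?_⟩)
        exact Set.disjoint_of_subset_left (hsp'.2.1.trans Set.subset_union_left) hd
      · have hsp' := r.instrAt_spec _ _ _ h
        obtain ⟨h1, h2⟩ := ihr _ (by grind) hbr hsr h
        have hqp : q ∉ p.labels := by grind
        have hfq : (ite l c p r rest).future q = r.future q ∪ rest.numAssigned := by
          simp [future, hq, hsp'.1, hqp]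
        rw [hfq]
        refine ⟨h1.trans Set.subset_union_left, fun s hsu => ?_⟩
        have hsub : (ite l c p r rest).future s ⊆ r.future s ∪ rest.numAssigned := by
          rcases hsp'.2.2 s hsu with rfl | h'
          · have hn1 : rest.entry follow ≠ l := by grind
            have hn2 : rest.entry follow ∉ p.labels := by grind
            have hn3 : rest.entry follow ∉ r.labels := by grind
            simp only [future, hn1, hn2, hn3, if_false]
            exact (rest.future_subset _).trans Set.subset_union_right
          · have hn1 : s ≠ l := by grind
            have hn2 : s ∉ p.labels := by grind
            simp [future, hn1, h', hn2]
        refine ⟨hsub.trans (Set.union_subset_union_left _ (h2 s hsu).1), ?_⟩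
        refine Set.disjoint_of_subset_right hsub (Set.disjoint_union_right.mpr ⟨(h2 s hsu).2, ?_⟩)
        exact Set.disjoint_of_subset_left (hsp'.2.1.trans Set.subset_union_right) hd
      · have hsp' := rest.instrAt_spec _ _ _ h
        obtain ⟨h1, h2⟩ := ih _ (by grind) hb hs h
        have key : ∀ s, s = follow ∨ s ∈ rest.labels →
            (ite l c p r rest).future s = rest.future s := by
          intro s hs'
          have hn1 : s ≠ l := by grind
          have hn2 : s ∉ p.labels := by grind
          have hn3 : s ∉ r.labels := by grind
          simp [future, hn1, hn2, hn3]
        rw [key q (.inr hsp'.1)]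
        refine ⟨h1, fun s hsu => ?_⟩
        rw [key s (hsp'.2.2 s hsu)]
        exact h2 s hsu
  | _ =>
    rename_i l c body rest ihb ih
    obtain ⟨hbb, hb⟩ := hb
    obtain ⟨hsb, hs, hd⟩ := hs
    simp only [labels, List.nodup_cons, List.nodup_append, List.mem_cons, List.mem_append,
      not_or] at hl
    obtain ⟨⟨hfl, hfb, hfrest⟩, ⟨hlb, hlrest⟩, hnb, hnrest, hbrest⟩ := hl
    have he := rest.entry_mem follow
    -- Every label, inside or outside the loop, has its future in `rest.numAssigned`, which is the
    -- future of the loop labels. No case distinction on jumps from the loop is needed.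
    have hsubs : ∀ s, (Block.while l c body rest).future s ⊆ rest.numAssigned := by
      intro s
      simp only [future]
      split_ifs
      · exact subset_rfl
      · exact rest.future_subset s
    simp only [instrAt] at h
    split_ifs at h with hq
    · obtain rfl := Option.some.inj h
      refine ⟨by simp [Instr.numTarget], fun s hsu => ⟨?_, by simp [Instr.numTarget]⟩⟩
      simpa [future, hq] using hsubs s
    · simp only [Option.or_eq_some_iff] at h
      rcases h with h | ⟨-, h⟩
      · have hsp' := body.instrAt_spec _ _ _ h
        have hemp : i.numTarget = ∅ := Set.subset_eq_empty hsp'.2.1 hbb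
        refine ⟨by simp [hemp], fun s hsu => ⟨?_, by simp [hemp]⟩⟩
        simpa [future, hsp'.1] using hsubs s
      · have hsp' := rest.instrAt_spec _ _ _ h
        obtain ⟨h1, h2⟩ := ih _ (by grind) hb hs h
        have key : ∀ s, s = follow ∨ s ∈ rest.labels →
            (Block.while l c body rest).future s = rest.future s := by
          intro s hs'
          have hn1 : s ≠ l := by grind
          have hn2 : s ∉ body.labels := by grind
          simp [future, hn1, hn2]
        rw [key q (.inr hsp'.1)]
        refine ⟨h1, fun s hsu => ?_⟩
        rw [key s (hsp'.2.2 s hsu)]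
        exact h2 s hsu

end Block

/-- An upper bound on the integer and real variables that may be assigned when the execution is
continued from the label `l`. -/
def Program.future (P : Program σ) (l : σ.Label) : Set (Var σ) := P.body.future l

theorem Program.IsDiPWhile.numTarget_subset {P : Program σ} (hP : P.IsDiPWhile) (l : σ.Label) :
    (P.instr l).numTarget ⊆ P.future l := by
  unfold Program.instr
  rcases h : P.body.instrAt P.last l with _ | i
  · simp [Instr.numTarget]
  · exact (P.body.future_succ _ _ _ hP.labels_unique hP.bounded hP.single h).1

/-- This is the source of freshness: the future decreases along every transition and loses a numeric
variable when it is assigned. Labels without a statement default to `exit` and have no successors.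
-/
theorem Program.IsDiPWhile.future_succ {P : Program σ} (hP : P.IsDiPWhile) (l : σ.Label)
    {s : σ.Label} (hs : s ∈ (P.instr l).succs) :
    P.future s ⊆ P.future l ∧ Disjoint (P.instr l).numTarget (P.future s) := by
  unfold Program.instr at hs ⊢
  rcases h : P.body.instrAt P.last l with _ | i
  · simp [h, Instr.succs] at hs
  · rw [h] at hs
    exact (P.body.future_succ _ _ _ hP.labels_unique hP.bounded hP.single h).2 s hs

/-! ### Expressions depend only on their variables -/

theorem IExp.eval_congr (e : IExp σ) (hX : σ.XVar → σ.Dom) {h h' : σ.ZVar → ℤ}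
    (hh : ∀ x, Var.int x ∈ e.vars → h x = h' x) : e.eval hX h = e.eval hX h' := by
  induction e with
  | var z => exact hh z rfl
  | constMul i e ih => simp only [eval, ih hh]
  | domMul d e ih => simp only [eval, ih fun x hx => hh x (.inr hx)]
  | add e₁ e₂ ih₁ ih₂ =>
    simp only [eval, ih₁ fun x hx => hh x (.inl hx), ih₂ fun x hx => hh x (.inr hx)]
  | addConst e i ih => simp only [eval, ih hh]
  | addDom e d ih => simp only [eval, ih fun x hx => hh x (.inl hx)]

theorem RExp.eval_congr (e : RExp σ) (hX : σ.XVar → σ.Dom) {h h' : σ.RVar → ℝ}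
    (hh : ∀ x, Var.real x ∈ e.vars → h x = h' x) : e.eval hX h = e.eval hX h' := by
  induction e with
  | var z => exact hh z rfl
  | constMul i e ih => simp only [eval, ih hh]
  | domMul d e ih => simp only [eval, ih fun x hx => hh x (.inr hx)]
  | add e₁ e₂ ih₁ ih₂ =>
    simp only [eval, ih₁ fun x hx => hh x (.inl hx), ih₂ fun x hx => hh x (.inr hx)]
  | addConst e i ih => simp only [eval, ih hh]
  | addDom e d ih => simp only [eval, ih fun x hx => hh x (.inl hx)]

theorem CExp.eval_congr (c : CExp σ) (hX : σ.XVar → σ.Dom) {h h' : σ.ZVar → ℤ}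
    {k k' : σ.RVar → ℝ} (hh : ∀ x, Var.int x ∈ c.vars → h x = h' x)
    (hk : ∀ x, Var.real x ∈ c.vars → k x = k' x) : c.eval hX h k = c.eval hX h' k' := by
  unfold CExp.eval
  congr 1
  cases c with
  | intInt rel e₁ e₂ =>
    simp only [Holds, e₁.eval_congr hX fun x hx => hh x (.inl hx),
      e₂.eval_congr hX fun x hx => hh x (.inr hx)]
  | intDom rel e d => simp only [Holds, e.eval_congr hX fun x hx => hh x (.inl hx)]
  | realReal rel e₁ e₂ =>
    simp only [Holds, e₁.eval_congr hX fun x hx => hk x (.inl hx),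
      e₂.eval_congr hX fun x hx => hk x (.inr hx)]
  | realDom rel e d => simp only [Holds, e.eval_congr hX fun x hx => hk x (.inl hx)]

/-! ### Partial evaluation -/

/-- No `DOM` variable survives partial evaluation, so the valuation `hX` is irrelevant. This
justifies evaluating recorded expressions at the constant valuation `0`. -/
theorem IExp.eval_peval (e : IExp σ) (val hX : σ.XVar → σ.Dom) (h : σ.ZVar → ℤ) :
    (e.peval val).eval hX h = e.eval val h := by
  induction e <;> simp_all [peval, eval, DExp.eval]

theorem RExp.eval_peval (e : RExp σ) (val hX : σ.XVar → σ.Dom) (h : σ.RVar → ℝ) :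
    (e.peval val).eval hX h = e.eval val h := by
  induction e <;> simp_all [peval, eval, DExp.eval]

theorem CExp.eval_peval (c : CExp σ) (val hX : σ.XVar → σ.Dom) (h : σ.ZVar → ℤ)
    (k : σ.RVar → ℝ) : (c.peval val).eval hX h k = c.eval val h k := by
  unfold CExp.eval
  congr 1
  cases c <;> simp [peval, Holds, IExp.eval_peval, RExp.eval_peval, DExp.eval]

theorem IExp.vars_peval (e : IExp σ) (val : σ.XVar → σ.Dom) : (e.peval val).vars ⊆ e.vars := by
  induction e <;> simp only [peval, vars, DExp.vars, Set.union_empty, Set.empty_union] <;> grind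

theorem RExp.vars_peval (e : RExp σ) (val : σ.XVar → σ.Dom) : (e.peval val).vars ⊆ e.vars := by
  induction e <;> simp only [peval, vars, DExp.vars, Set.union_empty, Set.empty_union] <;> grind

theorem CExp.vars_peval (c : CExp σ) (val : σ.XVar → σ.Dom) : (c.peval val).vars ⊆ c.vars := by
  cases c <;> simp only [peval, vars, DExp.vars, Set.union_empty] <;>
    grind [IExp.vars_peval, RExp.vars_peval]

/-! ### Hitting probabilities of a parametrized DTMC -/

namespace ParamDTMC

variable (M : ParamDTMC)

/-- The probability of reaching `T` from `z` in exactly `m` steps, and not before. -/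
def hitProb (T : Set M.State) (ε : PosReal) (m : ℕ) (z : M.State) : ℝ≥0∞ :=
  ∑' ρ : M.pathsTo z T m, M.pathProb ε ρ.1

open Classical in
-- With an indicator in place of the subtype, the index set no longer depends on the starting state,
-- so that sums can be reindexed and exchanged.
theorem hitProb_eq_tsum (T : Set M.State) (ε : PosReal) (m : ℕ) (z : M.State) :
    M.hitProb T ε m z =
      ∑' ρ : Fin (m + 1) → M.State, if ρ ∈ M.pathsTo z T m then M.pathProb ε ρ else 0 := by
  rw [hitProb, tsum_subtype (M.pathsTo z T m) (M.pathProb ε)]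
  simp only [Set.indicator_apply]

open Classical in
theorem hitProb_zero (T : Set M.State) (ε : PosReal) (z : M.State) :
    M.hitProb T ε 0 z = if z ∈ T then 1 else 0 := by
  rw [hitProb_eq_tsum, tsum_eq_single (fun _ => z)]
  · simp [pathsTo, pathProb]
  · intro ρ hρ
    rw [if_neg]
    rintro ⟨h, -, -⟩
    apply hρ
    funext i
    rw [Fin.fin_one_eq_zero i, h]

open Classical in
-- First-step decomposition: a sequence is a head followed by a tail, and both the condition on
-- paths and the product of transition probabilities factor accordingly.
theorem hitProb_succ (T : Set M.State) (ε : PosReal) (m : ℕ) (z : M.State) :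
    M.hitProb T ε (m + 1) z =
      if z ∈ T then 0 else ∑' z', M.trans z ε z' * M.hitProb T ε m z' := by
  have hcons : ∀ (a : M.State) (ρ : Fin (m + 1) → M.State),
      (if (Fin.cons a ρ : Fin (m + 1 + 1) → M.State) ∈ M.pathsTo z T (m + 1) then
        M.pathProb ε (Fin.cons a ρ : Fin (m + 1 + 1) → M.State) else 0) =
      if a = z then (if z ∈ T then 0 else
        M.trans z ε (ρ 0) * if ρ ∈ M.pathsTo (ρ 0) T m then M.pathProb ε ρ else 0) else 0 := by
    intro a ρ
    have h1 : (Fin.cons a ρ : Fin (m + 1 + 1) → M.State) ∈ M.pathsTo z T (m + 1) ↔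
        a = z ∧ a ∉ T ∧ ρ ∈ M.pathsTo (ρ 0) T m := by
      simp only [pathsTo, Set.mem_ofPred_eq, Fin.forall_fin_succ, ← Fin.succ_last,
        Fin.cons_succ, Fin.cons_zero, Fin.castSucc_zero, ← Fin.succ_castSucc]
      tauto
    have h2 : M.pathProb ε (Fin.cons a ρ : Fin (m + 1 + 1) → M.State) =
        M.trans a ε (ρ 0) * M.pathProb ε ρ := by
      simp only [pathProb, Fin.prod_univ_succ (n := m), Fin.castSucc_zero, Fin.cons_zero,
        Fin.cons_succ, ← Fin.succ_castSucc]
    rw [h2]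
    simp only [h1]
    by_cases ha : a = z
    · subst ha
      by_cases hT : a ∈ T <;> simp [hT]
    · simp [ha]
  rw [hitProb_eq_tsum, ← (Fin.consEquiv fun _ => M.State).tsum_eq]
  refine (tsum_congr fun c : M.State × (Fin (m + 1) → M.State) => hcons c.1 c.2).trans ?_
  rw [ENNReal.tsum_prod (f := fun a ρ => if a = z then (if z ∈ T then 0 else
    M.trans z ε (ρ 0) * if ρ ∈ M.pathsTo (ρ 0) T m then M.pathProb ε ρ else 0) else 0)]
  rw [tsum_eq_single z (fun a ha => by simp [ha])]
  by_cases hT : z ∈ T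
  · simp [hT]
  · simp only [hT, if_true, if_false]
    simp only [hitProb_eq_tsum, ← ENNReal.tsum_mul_left]
    rw [ENNReal.tsum_comm]
    refine tsum_congr fun ρ => ?_
    -- A tail `ρ` is counted only for the state `z'` at which it starts.
    rw [tsum_eq_single (ρ 0)]
    intro z' hz'
    rw [if_neg, mul_zero]
    rintro ⟨h, -, -⟩
    exact hz' h.symm

end ParamDTMC

/-! ### Forward visit probabilities and the cut at `exit` statements -/

theorem DState.step_of_isExit {P : Program σ} (z : DState P) (ε : PosReal)
    (h : P.IsExit z.label) : z.step ε = PMF.pure z := by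
  unfold Program.IsExit at h
  unfold DState.step
  split <;> simp_all

namespace Program

variable (P : Program σ)

open Classical in
/-- The probability that the chain of the DTMC semantics is in the state `z` after `m` steps and
was at no `exit` statement before. -/
def visitProb (ε : PosReal) (inp : P.InVal) : ℕ → DState P → ℝ≥0∞
  | 0, z => if z = P.dtmcInit inp then 1 else 0
  | m + 1, z' => ∑' z, if P.IsExit z.label then 0 else visitProb ε inp m z * z.step ε z'

/-- The probability of reaching the target from `z` in exactly `m` steps, and not before. -/
def hitProb (ε : PosReal) (out : P.OutVal) (m : ℕ) (z : DState P) : ℝ≥0∞ :=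
  P.dtmc.hitProb (P.dtmcTarget out) ε m z

open Classical in
theorem hitProb_zero (ε : PosReal) (out : P.OutVal) (z : DState P) :
    P.hitProb ε out 0 z = if z ∈ P.dtmcTarget out then 1 else 0 :=
  P.dtmc.hitProb_zero _ ε z

open Classical in
theorem hitProb_succ (ε : PosReal) (out : P.OutVal) (m : ℕ) (z : DState P) :
    P.hitProb ε out (m + 1) z = if z ∈ P.dtmcTarget out then 0 else
      ∑' z' : DState P, z.step ε z' * P.hitProb ε out m z' :=
  P.dtmc.hitProb_succ _ ε m z

theorem hitProb_of_isExit (ε : PosReal) (out : P.OutVal) (z : DState P) (h : P.IsExit z.label)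
    (hz : z ∉ P.dtmcTarget out) (m : ℕ) : P.hitProb ε out m z = 0 := by
  induction m with
  | zero => rw [hitProb_zero, if_neg hz]
  | succ m ih =>
    rw [hitProb_succ, if_neg hz, ENNReal.tsum_eq_zero]
    intro z'
    by_cases hz' : z' = z
    · rw [hz', ih, mul_zero]
    · rw [z.step_of_isExit ε h, PMF.pure_apply, if_neg hz', zero_mul]

open Classical in
-- Reachability stops at target states only, whereas executions stop at every `exit`. The recursion
-- may also be cut at the remaining `exit` states, because these are absorbing and never reach the
-- target.
theorem hitProb_succ_of_isExit (ε : PosReal) (out : P.OutVal) (m : ℕ) (z : DState P) :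
    P.hitProb ε out (m + 1) z = if P.IsExit z.label then 0 else
      ∑' z' : DState P, z.step ε z' * P.hitProb ε out m z' := by
  by_cases h : P.IsExit z.label
  · rw [if_pos h]
    by_cases hz : z ∈ P.dtmcTarget out
    · rw [hitProb_succ, if_pos hz]
    · exact P.hitProb_of_isExit ε out z h hz _
  · rw [if_neg h, hitProb_succ, if_neg fun hz => h hz.1]

open Classical in
theorem hitProb_dtmcInit (ε : PosReal) (inp : P.InVal) (out : P.OutVal) (m : ℕ) :
    P.hitProb ε out m (P.dtmcInit inp) =
      ∑' z, P.visitProb ε inp m z * if z ∈ P.dtmcTarget out then 1 else 0 := by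
  -- The forward recursion for `i` steps is paired with the backward recursion for `k` steps. Moving
  -- one step from the latter to the former does not change the sum; the case `k = 0` is the claim.
  have key : ∀ i k, ∑' z, P.visitProb ε inp i z * P.hitProb ε out k z =
      P.hitProb ε out (i + k) (P.dtmcInit inp) := by
    intro i
    induction i with
    | zero =>
      intro k
      rw [tsum_eq_single (P.dtmcInit inp) fun z hz => by simp [visitProb, hz]]
      simp [visitProb]
    | succ i ih =>
      intro k
      rw [show i + 1 + k = i + (k + 1) by ring, ← ih (k + 1)]
      simp only [hitProb_succ_of_isExit, visitProb, ← ENNReal.tsum_mul_right]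
      rw [ENNReal.tsum_comm]
      refine tsum_congr fun z => ?_
      by_cases h : P.IsExit z.label
      · simp [h]
      · simp only [h, if_false, mul_assoc, ENNReal.tsum_mul_left]
  rw [← add_zero m, ← key m 0]
  simp only [hitProb_zero, add_zero]

open Classical in
theorem probDTMC_eq_tsum (ε : PosReal) (inp : P.InVal) (out : P.OutVal) :
    P.probDTMC ε inp out =
      ∑' m, ∑' z, P.visitProb ε inp m z * if z ∈ P.dtmcTarget out then 1 else 0 :=
  tsum_congr fun m => P.hitProb_dtmcInit ε inp out m

/-! ### Executions -/

theorem measurable_snoc {α : Type} [MeasurableSpace α] (i : ℕ) :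
    Measurable fun p : (Fin (i + 1) → α) × α => (Fin.snoc (α := fun _ => α) p.1 p.2) := by
  refine measurable_pi_lambda _ fun j => ?_
  refine Fin.lastCases ?_ (fun j => ?_) j
  · simpa using measurable_snd
  · simpa [Function.comp_def] using (measurable_pi_apply (X := fun _ => α) j).comp measurable_fst

instance (ε : PosReal) (inp : P.InVal) (i : ℕ) : IsProbabilityMeasure (P.execLaw ε inp i) := by
  induction i with
  | zero => exact Measure.dirac.isProbabilityMeasure
  | succ i ih =>
    exact Measure.isProbabilityMeasure_map (measurable_snoc i).aemeasurable

theorem lintegral_execLaw_succ (ε : PosReal) (inp : P.InVal) (i : ℕ)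
    {F : (Fin (i + 1 + 1) → NState σ) → ℝ≥0∞} (hF : Measurable F) :
    ∫⁻ α, F α ∂(P.execLaw ε inp (i + 1)) =
      ∫⁻ α, ∫⁻ s, F (Fin.snoc (α := fun _ => NState σ) α s) ∂(P.natStep ε (α (Fin.last i)))
        ∂(P.execLaw ε inp i) := by
  rw [execLaw, lintegral_map hF (measurable_snoc i),
    Measure.lintegral_compProd (f := fun p => F (Fin.snoc (α := fun _ => NState σ) p.1 p.2))
      (hF.comp (measurable_snoc i))]
  rfl

/-- The input variables and the variables assigned by the statements with the labels `ls`. -/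
def assignedIn (ls : Set σ.Label) : Set (Var σ) :=
  {v | (∃ x ∈ P.inputs, v = .dom x) ∨ ∃ l ∈ ls, P.AssignsAt l v}

end Program

/-- The labels of the states of an execution other than the last one. -/
def pastLabels {i : ℕ} (α : Fin (i + 1) → NState σ) : Set σ.Label :=
  Set.range fun j : Fin i => (α j.castSucc).label

theorem pastLabels_snoc {i : ℕ} (α : Fin (i + 1) → NState σ) (s : NState σ) :
    pastLabels (i := i + 1) (Fin.snoc (α := fun _ => NState σ) α s) =
      insert (α (Fin.last i)).label (pastLabels α) := by
  ext l
  simp only [pastLabels, Set.mem_range, Set.mem_insert_iff, Fin.exists_fin_succ', Fin.snoc_castSucc]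
  tauto

theorem measurable_label : Measurable fun s : NState σ => s.label :=
  measurable_fst.comp measurable_fst

/-- Functions of the last state and of the labels of the previous states are measurable. -/
theorem measurable_last_pastLabels {i : ℕ} {g : NState σ → Set σ.Label → ℝ≥0∞}
    (hg : ∀ L, Measurable fun s => g s L) :
    Measurable fun α : Fin (i + 1) → NState σ => g (α (Fin.last i)) (pastLabels α) := by
  -- The label tuples range over a countable set, so measurability in the state for each fixed tuple
  -- suffices.
  have h : Measurable fun p : NState σ × (Fin i → σ.Label) => g p.1 (Set.range p.2) :=
    measurable_from_prod_countable_left fun ls => hg (Set.range ls)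
  refine h.comp (Measurable.prodMk (measurable_pi_apply (Fin.last i))
    (measurable_pi_lambda _ fun j => ?_))
  exact measurable_label.comp (measurable_pi_apply j.castSucc)

/-! ### Resampling one coordinate of a product measure -/

/-- It suffices to compare the measures on rectangles. Overwriting coordinate `j` discards its old
factor, which has total mass one, and inserts the new one. -/
theorem map_update_prod_pi {ι α : Type} [Fintype ι] [DecidableEq ι] [MeasurableSpace α]
    (μ μ' : ι → Measure α) [∀ i, IsProbabilityMeasure (μ i)] [∀ i, IsProbabilityMeasure (μ' i)]
    (j : ι) (h : ∀ i, i ≠ j → μ' i = μ i) :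
    ((Measure.pi μ).prod (μ' j)).map (fun p => Function.update p.1 j p.2) = Measure.pi μ' := by
  symm
  refine Measure.pi_eq fun s hs => ?_
  rw [Measure.map_apply measurable_update' (MeasurableSet.univ_pi hs)]
  -- The old coordinate `j` is unconstrained in the preimage of a rectangle.
  have : (fun p : (ι → α) × α => Function.update p.1 j p.2) ⁻¹' Set.univ.pi s =
      (Set.univ.pi (Function.update s j Set.univ)) ×ˢ s j := by
    ext ⟨f, y⟩
    simp only [Set.mem_preimage, Set.mem_univ_pi, Set.mem_prod]
    constructor
    · intro hf
      refine ⟨fun i => ?_, by simpa using hf j⟩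
      by_cases hi : i = j
      · subst hi; simp
      · simpa [hi] using hf i
    · rintro ⟨hf, hy⟩ i
      by_cases hi : i = j
      · subst hi; simpa using hy
      · simpa [hi] using hf i
  rw [this, Measure.prod_prod, Measure.pi_pi,
    ← Finset.mul_prod_erase Finset.univ _ (Finset.mem_univ j),
    ← Finset.mul_prod_erase Finset.univ (fun i => μ' i (s i)) (Finset.mem_univ j)]
  simp only [Function.update_self, measure_univ, one_mul]
  rw [mul_comm]
  congr 1
  refine Finset.prod_congr rfl fun i hi => ?_
  have hi := Finset.ne_of_mem_erase hi
  rw [Function.update_of_ne hi, h i hi]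

theorem lintegral_pi_eq_update {ι α : Type} [Fintype ι] [DecidableEq ι] [MeasurableSpace α]
    (μ μ' : ι → Measure α) [∀ i, IsProbabilityMeasure (μ i)] [∀ i, IsProbabilityMeasure (μ' i)]
    (j : ι) (h : ∀ i, i ≠ j → μ' i = μ i) {f : (ι → α) → ℝ≥0∞} (hf : Measurable f) :
    ∫⁻ x, f x ∂(Measure.pi μ') =
      ∫⁻ x, ∫⁻ y, f (Function.update x j y) ∂(μ' j) ∂(Measure.pi μ) := by
  rw [← map_update_prod_pi μ μ' j h, lintegral_map hf measurable_update',
    lintegral_prod (fun p : (ι → α) × α => f (Function.update p.1 j p.2))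
      (hf.comp measurable_update').aemeasurable]

/-! ### The values of the integer and real variables in a state of the DTMC semantics -/

/-- Values of the integer and real variables. -/
abbrev Vals (σ : Sig) : Type := (σ.ZVar → ℤ) × (σ.RVar → ℝ)

/-- Change the value of an integer variable. -/
def Vals.setInt (x : σ.ZVar) (v : Vals σ) (y : ℤ) : Vals σ := (Function.update v.1 x y, v.2)

/-- Change the value of a real variable. -/
def Vals.setReal (x : σ.RVar) (v : Vals σ) (y : ℝ) : Vals σ := (v.1, Function.update v.2 x y)

theorem Vals.measurable_setInt (x : σ.ZVar) :
    Measurable fun p : Vals σ × ℤ => Vals.setInt x p.1 p.2 :=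
  (measurable_update'.comp ((measurable_fst.comp measurable_fst).prodMk measurable_snd)).prodMk
    (measurable_snd.comp measurable_fst)

theorem Vals.measurable_setReal (x : σ.RVar) :
    Measurable fun p : Vals σ × ℝ => Vals.setReal x p.1 p.2 :=
  (measurable_fst.comp measurable_fst).prodMk
    (measurable_update'.comp ((measurable_snd.comp measurable_fst).prodMk measurable_snd))

theorem CExp.measurable_eval_vals (c : CExp σ) (hX : σ.XVar → σ.Dom) :
    Measurable fun v : Vals σ => c.eval hX v.1 v.2 :=
  measurable_from_prod_countable_right fun hZ => c.measurable_eval hX hZ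

namespace DState

variable {P : Program σ}

/-- The distribution of the sample for an integer variable. -/
def intNoise (z : DState P) (ε : PosReal) (x : σ.ZVar) : Measure ℤ :=
  match z.fZ x with
  | some (.inr (a, d)) => (DP.dLap (scale a ε) (d : ℤ)).toMeasure
  | _ => Measure.dirac 0

/-- The distribution of the sample for a real variable. -/
def realNoise (z : DState P) (ε : PosReal) (x : σ.RVar) : Measure ℝ :=
  match z.fR x with
  | some (.inr (a, d)) => DP.lap (scale a ε) ((d : ℤ) : ℝ)
  | _ => Measure.dirac 0

instance (z : DState P) (ε : PosReal) (x : σ.ZVar) : IsProbabilityMeasure (z.intNoise ε x) := by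
  unfold intNoise
  split <;> infer_instance

instance (z : DState P) (ε : PosReal) (x : σ.RVar) : IsProbabilityMeasure (z.realNoise ε x) := by
  unfold realNoise
  split <;> infer_instance

theorem noise_eq (z : DState P) (ε : PosReal) :
    z.noise ε = (Measure.pi (z.intNoise ε)).prod (Measure.pi (z.realNoise ε)) := rfl

instance (z : DState P) (ε : PosReal) : IsProbabilityMeasure (z.noise ε) := by
  rw [noise_eq]; infer_instance

/-- By Fubini the integer samples can be held fixed while one real coordinate is redrawn. The case
`z' = z` is also used: redrawing a coordinate from its own law preserves the noise. -/
theorem lintegral_noise_setReal {z z' : DState P} (ε : PosReal) (r : σ.RVar)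
    (hZ : z'.fZ = z.fZ) (hR : ∀ x, x ≠ r → z'.fR x = z.fR x) {f : Vals σ → ℝ≥0∞}
    (hf : Measurable f) :
    ∫⁻ ω, f ω ∂(z'.noise ε) =
      ∫⁻ ω, ∫⁻ y, f (Vals.setReal r ω y) ∂(z'.realNoise ε r) ∂(z.noise ε) := by
  have h1 : z'.intNoise ε = z.intNoise ε := by
    funext x; unfold intNoise; rw [hZ]
  have h2 : ∀ x, x ≠ r → z'.realNoise ε x = z.realNoise ε x := by
    intro x hx; unfold realNoise; rw [hR x hx]
  have hm : Measurable fun ω => ∫⁻ y, f (Vals.setReal r ω y) ∂(z'.realNoise ε r) :=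
    (hf.comp (Vals.measurable_setReal r)).lintegral_prod_right'
  rw [noise_eq, noise_eq, lintegral_prod _ hf.aemeasurable, lintegral_prod _ hm.aemeasurable, h1]
  refine lintegral_congr fun a => ?_
  exact lintegral_pi_eq_update _ _ r h2 (hf.comp measurable_prodMk_left)

theorem lintegral_noise_setInt {z z' : DState P} (ε : PosReal) (r : σ.ZVar)
    (hR : z'.fR = z.fR) (hZ : ∀ x, x ≠ r → z'.fZ x = z.fZ x) {f : Vals σ → ℝ≥0∞}
    (hf : Measurable f) :
    ∫⁻ ω, f ω ∂(z'.noise ε) =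
      ∫⁻ ω, ∫⁻ y, f (Vals.setInt r ω y) ∂(z'.intNoise ε r) ∂(z.noise ε) := by
  have h1 : z'.realNoise ε = z.realNoise ε := by
    funext x; unfold realNoise; rw [hR]
  have h2 : ∀ x, x ≠ r → z'.intNoise ε x = z.intNoise ε x := by
    intro x hx; unfold intNoise; rw [hZ x hx]
  have hm : Measurable fun ω => ∫⁻ y, f (Vals.setInt r ω y) ∂(z'.intNoise ε r) :=
    (hf.comp (Vals.measurable_setInt r)).lintegral_prod_right'
  -- The order of integration is reversed, so that the integer samples form the inner integral.
  rw [noise_eq, noise_eq, lintegral_prod_symm _ hf.aemeasurable,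
    lintegral_prod_symm _ hm.aemeasurable, h1]
  refine lintegral_congr fun a => ?_
  exact lintegral_pi_eq_update _ _ r h2 (hf.comp measurable_prodMk_right)

/-- The values determined by the samples. -/
def solve (z : DState P) (ω : Vals σ) : Vals σ := Classical.epsilon (z.Determines ω)

/-- The arbitrary choice in `solve` is harmless as soon as the equations have exactly one solution.
-/
theorem solve_eq {z : DState P} {V : Vals σ → Vals σ}
    (h : ∀ ω v, z.Determines ω v ↔ v = V ω) : z.solve = V := by
  funext ω
  exact (h ω _).mp (Classical.epsilon_spec (p := z.Determines ω) ⟨V ω, (h ω _).mpr rfl⟩)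

/-- The joint law of the values of the integer and real variables, disregarding the conditions. -/
def valueLaw (z : DState P) (ε : PosReal) : Measure (Vals σ) := (z.noise ε).map z.solve

/-- The values that satisfy the conditions in `C`. -/
def sat (C : Set (Bool × P.bExp)) : Set (Vals σ) :=
  {v | ∀ c ∈ C, c.2.1.eval (fun _ => 0) v.1 v.2 = c.1}

theorem measurableSet_sat (C : Set (Bool × P.bExp)) : MeasurableSet (sat C) := by
  have := P.finite_bExp.to_subtype
  have : sat C = ⋂ c ∈ C, (fun v : Vals σ => c.2.1.eval (fun _ => 0) v.1 v.2) ⁻¹' {c.1} := by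
    ext v; simp [sat]
  rw [this]
  exact MeasurableSet.biInter C.to_countable fun c _ =>
    c.2.1.measurable_eval_vals _ (measurableSet_singleton _)

/-- The probability of the conditions of the state. -/
def weight (z : DState P) (ε : PosReal) : ℝ≥0∞ := z.valueLaw ε (sat z.conds)

/-- The state of the Markov kernel semantics with given values of the integer and real
variables. -/
def toNState (z : DState P) (v : Vals σ) : NState σ := ((z.label, z.boolVal, z.domVal, v.1), v.2)

theorem measurable_toNState (z : DState P) : Measurable z.toNState :=
  Measurable.prodMk (measurable_const.prodMk (measurable_const.prodMk
    (measurable_const.prodMk measurable_fst))) measurable_snd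

/-- The expectation of a function of the state of the Markov kernel semantics, given the conditions
of a state of the DTMC semantics. -/
def expect (z : DState P) (ε : PosReal) (f : NState σ → ℝ≥0∞) : ℝ≥0∞ :=
  (z.weight ε)⁻¹ * ∫⁻ v in sat z.conds, f (z.toNState v) ∂(z.valueLaw ε)

/-- The variables that have a value. -/
def defined (z : DState P) : Set (Var σ) :=
  {v | match v with
    | .bool b => (z.fB b).isSome
    | .dom x => (z.fX x).isSome
    | .int x => (z.fZ x).isSome
    | .real x => (z.fR x).isSome}

@[simp] theorem bool_mem_defined {z : DState P} {b} : .bool b ∈ z.defined ↔ (z.fB b).isSome :=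
  Iff.rfl

@[simp] theorem dom_mem_defined {z : DState P} {b} : .dom b ∈ z.defined ↔ (z.fX b).isSome :=
  Iff.rfl

@[simp] theorem int_mem_defined {z : DState P} {b} : .int b ∈ z.defined ↔ (z.fZ b).isSome :=
  Iff.rfl

@[simp] theorem real_mem_defined {z : DState P} {b} : .real b ∈ z.defined ↔ (z.fR b).isSome :=
  Iff.rfl

/-- The properties of reachable states. -/
structure WellFormed (z : DState P) : Prop where
  measurable_solve : Measurable z.solve
  determines_iff : ∀ ω v, z.Determines ω v ↔ v = z.solve ω
  fZ_vars : ∀ x e, z.fZ x = some (.inl e) → e.1.vars ⊆ z.defined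
  fR_vars : ∀ x e, z.fR x = some (.inl e) → e.1.vars ⊆ z.defined
  conds_vars : ∀ c ∈ z.conds, c.2.1.vars ⊆ z.defined
  -- This is freshness: a numeric variable that may still be assigned has no value yet.
  future : Disjoint (P.future z.label) z.defined

theorem WellFormed.isProbabilityMeasure {z : DState P} (hz : z.WellFormed) (ε : PosReal) :
    IsProbabilityMeasure (z.valueLaw ε) :=
  Measure.isProbabilityMeasure_map hz.measurable_solve.aemeasurable

/-- The event quantifies existentially over solutions of the recorded equations. Uniqueness of the
solution turns it into a preimage under `solve`, so the probabilities in `condProb` become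
probabilities of the value law. -/
theorem WellFormed.noise_event {z : DState P} (hz : z.WellFormed) (ε : PosReal)
    (C : Set (Bool × P.bExp)) : z.noise ε (z.event C) = z.valueLaw ε (sat C) := by
  have h : z.event C = z.solve ⁻¹' sat C := by
    ext ω
    simp [event, sat, hz.determines_iff]
  rw [h, valueLaw, Measure.map_apply hz.measurable_solve (measurableSet_sat C)]

end DState

theorem Block.isNumeric_of_mem_numAssigned (B : Block σ) {v : Var σ} (hv : v ∈ B.numAssigned) :
    v.IsNumeric := by
  induction B with
  | nil => exact hv.elim
  | asgn l a rest ih => exact hv.elim (fun h => h.2) ih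
  | exit l rest ih => exact ih hv
  | ite l c p q rest ihp ihq ih => exact hv.elim (fun h => h.elim ihp ihq) ih
  | _ =>
    rename_i l c body rest ihb ih
    exact hv.elim ihb ih

theorem Vals.setInt_setInt (x : σ.ZVar) (v : Vals σ) (y y' : ℤ) :
    Vals.setInt x (Vals.setInt x v y) y' = Vals.setInt x v y' := by
  simp [Vals.setInt]

theorem Vals.setReal_setReal (x : σ.RVar) (v : Vals σ) (y y' : ℝ) :
    Vals.setReal x (Vals.setReal x v y) y' = Vals.setReal x v y' := by
  simp [Vals.setReal]

theorem IExp.eval_setInt (e : IExp σ) (hX : σ.XVar → σ.Dom) {x : σ.ZVar} (hx : .int x ∉ e.vars)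
    (v : Vals σ) (y : ℤ) : e.eval hX (Vals.setInt x v y).1 = e.eval hX v.1 :=
  e.eval_congr hX fun x' hx' => Function.update_of_ne (by rintro rfl; exact hx hx') _ _

theorem RExp.eval_setReal (e : RExp σ) (hX : σ.XVar → σ.Dom) {x : σ.RVar}
    (hx : .real x ∉ e.vars) (v : Vals σ) (y : ℝ) :
    e.eval hX (Vals.setReal x v y).2 = e.eval hX v.2 :=
  e.eval_congr hX fun x' hx' => Function.update_of_ne (by rintro rfl; exact hx hx') _ _

theorem RExp.measurable_eval_vals (e : RExp σ) (hX : σ.XVar → σ.Dom) :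
    Measurable fun v : Vals σ => e.eval hX v.2 :=
  (e.measurable_eval hX).comp measurable_snd

theorem IExp.measurable_eval_vals (e : IExp σ) (hX : σ.XVar → σ.Dom) :
    Measurable fun v : Vals σ => e.eval hX v.1 :=
  (Measurable.of_discrete (f := fun h : σ.ZVar → ℤ => e.eval hX h)).comp measurable_fst

namespace DState

variable {P : Program σ}

theorem sat_setInt {C : Set (Bool × P.bExp)} {x : σ.ZVar} (hx : ∀ c ∈ C, .int x ∉ c.2.1.vars)
    (v : Vals σ) (y : ℤ) : Vals.setInt x v y ∈ sat C ↔ v ∈ sat C := by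
  refine forall₂_congr fun c hc => ?_
  rw [c.2.1.eval_congr (fun _ => 0) (h' := v.1) (k' := v.2)]
  · exact fun x' hx' => Function.update_of_ne (by rintro rfl; exact hx c hc hx') _ _
  · exact fun _ _ => rfl

theorem sat_setReal {C : Set (Bool × P.bExp)} {x : σ.RVar} (hx : ∀ c ∈ C, .real x ∉ c.2.1.vars)
    (v : Vals σ) (y : ℝ) : Vals.setReal x v y ∈ sat C ↔ v ∈ sat C := by
  refine forall₂_congr fun c hc => ?_
  rw [c.2.1.eval_congr (fun _ => 0) (h' := v.1) (k' := v.2)]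
  · exact fun _ _ => rfl
  · exact fun x' hx' => Function.update_of_ne (by rintro rfl; exact hx c hc hx') _ _

/-! ### Assignments to integer and real variables -/

/-- The common pattern of integer and real assignments. `U` overwrites one coordinate, and `y₀` is
the value of its sample before the assignment (`hn`). Afterwards the sample is drawn from `ν`
(`hn'`), and the new solution is the old one with the coordinate overwritten by `h y v` (`hsolve`).
The claim follows by changing variables on both sides. -/
theorem lintegral_valueLaw_of_solve {z z' : DState P} {ε : PosReal} {α : Type} [MeasurableSpace α]
    {ν : Measure α} [SFinite ν] {U : Vals σ → α → Vals σ} {y₀ : α} {h : α → Vals σ → α}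
    (hU : Measurable fun p : Vals σ × α => U p.1 p.2)
    (hh : Measurable fun p : Vals σ × α => h p.2 p.1)
    (hn : ∀ f : Vals σ → ℝ≥0∞, Measurable f →
      ∫⁻ ω, f ω ∂(z.noise ε) = ∫⁻ ω, f (U ω y₀) ∂(z.noise ε))
    (hn' : ∀ f : Vals σ → ℝ≥0∞, Measurable f →
      ∫⁻ ω, f ω ∂(z'.noise ε) = ∫⁻ ω, ∫⁻ y, f (U ω y) ∂ν ∂(z.noise ε))
    (hs : Measurable z.solve) (hs' : Measurable z'.solve)
    (hsolve : ∀ ω y, z'.solve (U ω y) = U (z.solve (U ω y₀)) (h y (z.solve (U ω y₀))))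
    {f : Vals σ → ℝ≥0∞} (hf : Measurable f) :
    ∫⁻ v, f v ∂(z'.valueLaw ε) = ∫⁻ v, ∫⁻ y, f (U v (h y v)) ∂ν ∂(z.valueLaw ε) := by
  have hk : Measurable fun v => ∫⁻ y, f (U v (h y v)) ∂ν :=
    (hf.comp (hU.comp (measurable_fst.prodMk hh))).lintegral_prod_right'
  rw [valueLaw, valueLaw, lintegral_map hf hs', lintegral_map hk hs,
    hn' (fun ω => f (z'.solve ω)) (hf.comp hs')]
  refine Eq.trans ?_ (hn _ (hk.comp hs)).symm
  simp only [hsolve, Function.comp_apply]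

/-- The conditions do not see the overwritten coordinate (`hsat`), so restricting to them commutes
with the assignment and their probability is unchanged. -/
theorem expect_of_assign {z z' : DState P} {ε : PosReal} {α : Type} [MeasurableSpace α]
    {ν : Measure α} [IsProbabilityMeasure ν] {U : Vals σ → α → Vals σ} {h : α → Vals σ → α}
    (hlaw : ∀ f : Vals σ → ℝ≥0∞, Measurable f →
      ∫⁻ v, f v ∂(z'.valueLaw ε) = ∫⁻ v, ∫⁻ y, f (U v (h y v)) ∂ν ∂(z.valueLaw ε))
    (hc : z'.conds = z.conds) (hsat : ∀ v y, U v y ∈ sat z.conds ↔ v ∈ sat z.conds) :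
    z'.weight ε = z.weight ε ∧ ∀ f : NState σ → ℝ≥0∞, Measurable f →
      z'.expect ε f = (z.weight ε)⁻¹ *
        ∫⁻ v in sat z.conds, ∫⁻ y, f (z'.toNState (U v (h y v))) ∂ν ∂(z.valueLaw ε) := by
  have key : ∀ f : Vals σ → ℝ≥0∞, Measurable f → ∫⁻ v in sat z.conds, f v ∂(z'.valueLaw ε) =
      ∫⁻ v in sat z.conds, ∫⁻ y, f (U v (h y v)) ∂ν ∂(z.valueLaw ε) := by
    intro f hf
    rw [← lintegral_indicator (measurableSet_sat _), ← lintegral_indicator (measurableSet_sat _),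
      hlaw _ (hf.indicator (measurableSet_sat _))]
    refine lintegral_congr fun v => ?_
    by_cases hv : v ∈ sat z.conds
    · simp only [Set.indicator, hsat, hv, if_true]
    · simp only [Set.indicator, hsat, hv, if_false, lintegral_zero]
  have hw : z'.weight ε = z.weight ε := by
    -- The constant function `1` gives equality of the weights, since `ν` has total mass one.
    have := key (fun _ => 1) measurable_const
    simpa [weight, hc] using this
  refine ⟨hw, fun f hf => ?_⟩
  rw [expect, hw, hc, key (fun v => f (z'.toNState v)) (hf.comp z'.measurable_toNState)]

/-- No expression recorded in `z` mentions the fresh variable `r`, so the equations of the other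
variables do not see coordinate `r` of the samples or the values. After both are reset to `0`, the
equation of `z` at `r` is trivial, and only the new equation at `r` remains. -/
theorem determines_setReal {z z' : DState P} (hz : z.WellFormed) {r : σ.RVar} (hr : z.fR r = none)
    (hZ : z'.fZ = z.fZ) (hR : ∀ x, x ≠ r → z'.fR x = z.fR x) (ω v : Vals σ) :
    z'.Determines ω v ↔ z.Determines (Vals.setReal r ω 0) (Vals.setReal r v 0) ∧
      (match z'.fR r with
        | some (.inl e) => v.2 r = e.1.eval (fun _ => 0) v.2
        | _ => v.2 r = ω.2 r) := by
  unfold Determines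
  rw [hZ, and_assoc]
  refine and_congr Iff.rfl ⟨fun h => ⟨fun x => ?_, h r⟩, fun h x => ?_⟩
  · by_cases hx : x = r
    · subst hx
      simp [hr, Vals.setReal]
    · have h := h x
      rw [hR x hx] at h
      rcases hfx : z.fR x with _ | e | d
      · simpa [hfx, hx, Vals.setReal] using h
      · have hre : .real r ∉ e.1.vars := fun hmem => by
          have := hz.fR_vars x e hfx hmem
          simp [hr] at this
        simp only [hfx] at h ⊢
        rw [e.1.eval_setReal _ hre]
        simpa [hx, Vals.setReal] using h
      · simpa [hfx, hx, Vals.setReal] using h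
  · by_cases hx : x = r
    · subst hx
      exact h.2
    · have h := h.1 x
      rw [hR x hx]
      rcases hfx : z.fR x with _ | e | d
      · simpa [hfx, hx, Vals.setReal] using h
      · have hre : .real r ∉ e.1.vars := fun hmem => by
          have := hz.fR_vars x e hfx hmem
          simp [hr] at this
        simp only [hfx] at h ⊢
        rw [e.1.eval_setReal _ hre] at h
        simpa [hx, Vals.setReal] using h
      · simpa [hfx, hx, Vals.setReal] using h

theorem determines_setInt {z z' : DState P} (hz : z.WellFormed) {r : σ.ZVar} (hr : z.fZ r = none)
    (hR : z'.fR = z.fR) (hZ : ∀ x, x ≠ r → z'.fZ x = z.fZ x) (ω v : Vals σ) :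
    z'.Determines ω v ↔ z.Determines (Vals.setInt r ω 0) (Vals.setInt r v 0) ∧
      (match z'.fZ r with
        | some (.inl e) => v.1 r = e.1.eval (fun _ => 0) v.1
        | _ => v.1 r = ω.1 r) := by
  unfold Determines
  rw [hR, and_right_comm]
  refine and_congr ⟨fun h => ⟨fun x => ?_, h r⟩, fun h x => ?_⟩ Iff.rfl
  · by_cases hx : x = r
    · subst hx
      simp [hr, Vals.setInt]
    · have h := h x
      rw [hZ x hx] at h
      rcases hfx : z.fZ x with _ | e | d
      · simpa [hfx, hx, Vals.setInt] using h
      · have hre : .int r ∉ e.1.vars := fun hmem => by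
          have := hz.fZ_vars x e hfx hmem
          simp [hr] at this
        simp only [hfx] at h ⊢
        rw [e.1.eval_setInt _ hre]
        simpa [hx, Vals.setInt] using h
      · simpa [hfx, hx, Vals.setInt] using h
  · by_cases hx : x = r
    · subst hx
      exact h.2
    · have h := h.1 x
      rw [hZ x hx]
      rcases hfx : z.fZ x with _ | e | d
      · simpa [hfx, hx, Vals.setInt] using h
      · have hre : .int r ∉ e.1.vars := fun hmem => by
          have := hz.fZ_vars x e hfx hmem
          simp [hr] at this
        simp only [hfx] at h ⊢
        rw [e.1.eval_setInt _ hre] at h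
        simpa [hx, Vals.setInt] using h
      · simpa [hfx, hx, Vals.setInt] using h

theorem solve_real_of_none {z : DState P} (hz : z.WellFormed) {r : σ.RVar} (hr : z.fR r = none)
    (ω : Vals σ) : (z.solve ω).2 r = ω.2 r := by
  have := ((hz.determines_iff ω _).mpr rfl).2 r
  simpa [hr] using this

theorem solve_int_of_none {z : DState P} (hz : z.WellFormed) {r : σ.ZVar} (hr : z.fZ r = none)
    (ω : Vals σ) : (z.solve ω).1 r = ω.1 r := by
  have := ((hz.determines_iff ω _).mpr rfl).1 r
  simpa [hr] using this

/-- Values are determined after a real variable has been sampled or assigned. -/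
theorem determines_iff_setReal {z z' : DState P} (hz : z.WellFormed) {r : σ.RVar}
    (hr : z.fR r = none) (hZ : z'.fZ = z.fZ) (hR : ∀ x, x ≠ r → z'.fR x = z.fR x)
    {h : ℝ → Vals σ → ℝ} (hset : ∀ y v y', h y (Vals.setReal r v y') = h y v)
    (heq : ∀ ω v : Vals σ, (match z'.fR r with
        | some (.inl e) => v.2 r = e.1.eval (fun _ => 0) v.2
        | _ => v.2 r = ω.2 r) ↔ v.2 r = h (ω.2 r) v) (ω v : Vals σ) :
    z'.Determines ω v ↔ v = Vals.setReal r (z.solve (Vals.setReal r ω 0))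
      (h (ω.2 r) (z.solve (Vals.setReal r ω 0))) := by
  rw [determines_setReal hz hr hZ hR, heq, hz.determines_iff]
  have h0 := solve_real_of_none hz hr (Vals.setReal r ω 0)
  generalize z.solve (Vals.setReal r ω 0) = s at *
  constructor
  · rintro ⟨h1, h2⟩
    rw [← h1, hset, Vals.setReal_setReal, ← h2]
    simp [Vals.setReal]
  · rintro rfl
    rw [Vals.setReal_setReal, hset]
    refine ⟨?_, by simp [Vals.setReal]⟩
    refine Prod.ext rfl ?_
    -- A variable without a recorded entry takes the value of its sample, here `0`; resetting it to
    -- `0` therefore does nothing to `s`.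
    have : (0 : ℝ) = s.2 r := by simp [h0, Vals.setReal]
    simp [Vals.setReal, this]

/-- Values are determined after an integer variable has been sampled or assigned. -/
theorem determines_iff_setInt {z z' : DState P} (hz : z.WellFormed) {r : σ.ZVar}
    (hr : z.fZ r = none) (hR : z'.fR = z.fR) (hZ : ∀ x, x ≠ r → z'.fZ x = z.fZ x)
    {h : ℤ → Vals σ → ℤ} (hset : ∀ y v y', h y (Vals.setInt r v y') = h y v)
    (heq : ∀ ω v : Vals σ, (match z'.fZ r with
        | some (.inl e) => v.1 r = e.1.eval (fun _ => 0) v.1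
        | _ => v.1 r = ω.1 r) ↔ v.1 r = h (ω.1 r) v) (ω v : Vals σ) :
    z'.Determines ω v ↔ v = Vals.setInt r (z.solve (Vals.setInt r ω 0))
      (h (ω.1 r) (z.solve (Vals.setInt r ω 0))) := by
  rw [determines_setInt hz hr hR hZ, heq, hz.determines_iff]
  have h0 := solve_int_of_none hz hr (Vals.setInt r ω 0)
  generalize z.solve (Vals.setInt r ω 0) = s at *
  constructor
  · rintro ⟨h1, h2⟩
    rw [← h1, hset, Vals.setInt_setInt, ← h2]
    simp [Vals.setInt]
  · rintro rfl
    rw [Vals.setInt_setInt, hset]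
    refine ⟨?_, by simp [Vals.setInt]⟩
    refine Prod.ext ?_ rfl
    have : (0 : ℤ) = s.1 r := by simp [h0, Vals.setInt]
    simp [Vals.setInt, this]

/-- The old variables stay outside the smaller future. The target is outside it by single assignment
if it is numeric, and trivially otherwise, as futures contain numeric variables only. -/
theorem disjoint_future_of_assign (hP : P.IsDiPWhile) {z z' : DState P} (hz : z.WellFormed)
    {a : Asgn σ} (hi : P.instr z.label = .asgn a z'.label)
    (hd : z'.defined = insert a.target z.defined) : Disjoint (P.future z'.label) z'.defined := by
  have h := hP.future_succ z.label (s := z'.label) (by simp [hi, Instr.succs])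
  rw [hi] at h
  rw [hd, Set.disjoint_left]
  rintro v hv (rfl | hv')
  · refine Set.disjoint_left.mp h.2 ⟨rfl, ?_⟩ hv
    exact P.body.isNumeric_of_mem_numAssigned (P.body.future_subset _ hv)
  · exact Set.disjoint_left.mp hz.future (h.1 hv) hv'

/-- The effect of an assignment or sampling of a real variable; `h y v` is the new value if the
sample is `y` and the values are `v`. -/
theorem setReal_spec (hP : P.IsDiPWhile) {z z' : DState P} (hz : z.WellFormed) {r : σ.RVar}
    (ε : PosReal) {a : Asgn σ} (hi : P.instr z.label = .asgn a z'.label) (ha : a.target = .real r)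
    (hd : z'.defined = insert a.target z.defined)
    (hZ : z'.fZ = z.fZ) (hR : ∀ x, x ≠ r → z'.fR x = z.fR x) (hc : z'.conds = z.conds)
    (hv : ∀ e, z'.fR r = some (.inl e) → e.1.vars ⊆ z.defined)
    {h : ℝ → Vals σ → ℝ} (hh : Measurable fun p : Vals σ × ℝ => h p.2 p.1)
    (hset : ∀ y v y', h y (Vals.setReal r v y') = h y v)
    (heq : ∀ ω v : Vals σ, (match z'.fR r with
        | some (.inl e) => v.2 r = e.1.eval (fun _ => 0) v.2
        | _ => v.2 r = ω.2 r) ↔ v.2 r = h (ω.2 r) v) :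
    z'.WellFormed ∧ z'.weight ε = z.weight ε ∧ ∀ f : NState σ → ℝ≥0∞, Measurable f →
      z'.expect ε f = (z.weight ε)⁻¹ * ∫⁻ v in sat z.conds,
        ∫⁻ y, f (z'.toNState (Vals.setReal r v (h y v))) ∂(z'.realNoise ε r) ∂(z.valueLaw ε) := by
  have hfut : .real r ∈ P.future z.label := by
    refine hP.numTarget_subset z.label ?_
    rw [hi]
    exact ⟨ha.symm, trivial⟩
  have hnd : .real r ∉ z.defined := Set.disjoint_left.mp hz.future hfut
  -- Freshness: this label may assign `r`, so `r` belongs to the future and has no recorded value.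
  have hr : z.fR r = none := by simpa using hnd
  have hdet := determines_iff_setReal hz hr hZ hR hset heq
  have hsolve := solve_eq hdet
  have hU0 : Measurable fun ω : Vals σ => Vals.setReal r ω 0 :=
    (Vals.measurable_setReal r).comp (measurable_id.prodMk measurable_const)
  have hms : Measurable z'.solve := by
    rw [hsolve]
    have h1 := hz.measurable_solve.comp hU0
    refine (Vals.measurable_setReal r).comp (h1.prodMk (hh.comp (h1.prodMk ?_)))
    exact (measurable_pi_apply r).comp measurable_snd
  have hsub : z.defined ⊆ z'.defined := hd ▸ Set.subset_insert _ _
  have hwf : z'.WellFormed := by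
    refine ⟨hms, by rwa [hsolve], fun x e hx => ?_, fun x e hx => ?_, ?_,
      disjoint_future_of_assign hP hz hi hd⟩
    · exact (hz.fZ_vars x e (hZ ▸ hx)).trans hsub
    · by_cases hxr : x = r
      · subst hxr
        exact (hv e hx).trans hsub
      · exact (hz.fR_vars x e (hR x hxr ▸ hx)).trans hsub
    · rw [hc]
      exact fun c hc => (hz.conds_vars c hc).trans hsub
  refine ⟨hwf, ?_⟩
  refine expect_of_assign (U := Vals.setReal r) (fun f hf => ?_) hc
    (sat_setReal fun c hc hmem => hnd (hz.conds_vars c hc hmem))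
  refine lintegral_valueLaw_of_solve (y₀ := 0) (Vals.measurable_setReal r) hh (fun f hf => ?_)
    (fun f hf => lintegral_noise_setReal ε r hZ hR hf) hz.measurable_solve hms (fun ω y => ?_) hf
  · rw [lintegral_noise_setReal (z := z) ε r rfl (fun _ _ => rfl) hf]
    refine lintegral_congr fun ω => ?_
    have : z.realNoise ε r = Measure.dirac 0 := by simp [realNoise, hr]
    rw [this, lintegral_dirac]
  · rw [hsolve]
    simp only [Vals.setReal_setReal]
    simp [Vals.setReal]

/-- The effect of an assignment or sampling of an integer variable; `h y v` is the new value if the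
sample is `y` and the values are `v`. -/
theorem setInt_spec (hP : P.IsDiPWhile) {z z' : DState P} (hz : z.WellFormed) {r : σ.ZVar}
    (ε : PosReal) {a : Asgn σ} (hi : P.instr z.label = .asgn a z'.label) (ha : a.target = .int r)
    (hd : z'.defined = insert a.target z.defined)
    (hR : z'.fR = z.fR) (hZ : ∀ x, x ≠ r → z'.fZ x = z.fZ x) (hc : z'.conds = z.conds)
    (hv : ∀ e, z'.fZ r = some (.inl e) → e.1.vars ⊆ z.defined)
    {h : ℤ → Vals σ → ℤ} (hh : Measurable fun p : Vals σ × ℤ => h p.2 p.1)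
    (hset : ∀ y v y', h y (Vals.setInt r v y') = h y v)
    (heq : ∀ ω v : Vals σ, (match z'.fZ r with
        | some (.inl e) => v.1 r = e.1.eval (fun _ => 0) v.1
        | _ => v.1 r = ω.1 r) ↔ v.1 r = h (ω.1 r) v) :
    z'.WellFormed ∧ z'.weight ε = z.weight ε ∧ ∀ f : NState σ → ℝ≥0∞, Measurable f →
      z'.expect ε f = (z.weight ε)⁻¹ * ∫⁻ v in sat z.conds,
        ∫⁻ y, f (z'.toNState (Vals.setInt r v (h y v))) ∂(z'.intNoise ε r) ∂(z.valueLaw ε) := by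
  have hfut : .int r ∈ P.future z.label := by
    refine hP.numTarget_subset z.label ?_
    rw [hi]
    exact ⟨ha.symm, trivial⟩
  have hnd : .int r ∉ z.defined := Set.disjoint_left.mp hz.future hfut
  -- Freshness, as in the real case.
  have hr : z.fZ r = none := by simpa using hnd
  have hdet := determines_iff_setInt hz hr hR hZ hset heq
  have hsolve := solve_eq hdet
  have hU0 : Measurable fun ω : Vals σ => Vals.setInt r ω 0 :=
    (Vals.measurable_setInt r).comp (measurable_id.prodMk measurable_const)
  have hms : Measurable z'.solve := by
    rw [hsolve]
    have h1 := hz.measurable_solve.comp hU0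
    refine (Vals.measurable_setInt r).comp (h1.prodMk (hh.comp (h1.prodMk ?_)))
    exact (measurable_pi_apply r).comp measurable_fst
  have hsub : z.defined ⊆ z'.defined := hd ▸ Set.subset_insert _ _
  have hwf : z'.WellFormed := by
    refine ⟨hms, by rwa [hsolve], fun x e hx => ?_, fun x e hx => ?_, ?_,
      disjoint_future_of_assign hP hz hi hd⟩
    · by_cases hxr : x = r
      · subst hxr
        exact (hv e hx).trans hsub
      · exact (hz.fZ_vars x e (hZ x hxr ▸ hx)).trans hsub
    · exact (hz.fR_vars x e (hR ▸ hx)).trans hsub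
    · rw [hc]
      exact fun c hc => (hz.conds_vars c hc).trans hsub
  refine ⟨hwf, ?_⟩
  refine expect_of_assign (U := Vals.setInt r) (fun f hf => ?_) hc
    (sat_setInt fun c hc hmem => hnd (hz.conds_vars c hc hmem))
  refine lintegral_valueLaw_of_solve (y₀ := 0) (Vals.measurable_setInt r) hh (fun f hf => ?_)
    (fun f hf => lintegral_noise_setInt ε r hR hZ hf) hz.measurable_solve hms (fun ω y => ?_) hf
  · rw [lintegral_noise_setInt (z := z) ε r rfl (fun _ _ => rfl) hf]
    refine lintegral_congr fun ω => ?_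
    have : z.intNoise ε r = Measure.dirac 0 := by simp [intNoise, hr]
    rw [this, lintegral_dirac]
  · rw [hsolve]
    simp only [Vals.setInt_setInt]
    simp [Vals.setInt]

/-! ### The other statements -/

theorem determines_congr {z z' : DState P} (hZ : z'.fZ = z.fZ) (hR : z'.fR = z.fR) :
    z'.Determines = z.Determines := by
  unfold Determines; rw [hZ, hR]

theorem solve_congr {z z' : DState P} (hZ : z'.fZ = z.fZ) (hR : z'.fR = z.fR) :
    z'.solve = z.solve := by
  unfold solve; rw [determines_congr hZ hR]

theorem valueLaw_congr {z z' : DState P} (ε : PosReal) (hZ : z'.fZ = z.fZ) (hR : z'.fR = z.fR) :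
    z'.valueLaw ε = z.valueLaw ε := by
  unfold valueLaw; rw [solve_congr hZ hR]
  unfold noise; rw [hZ, hR]

theorem WellFormed.congr {z z' : DState P} (hz : z.WellFormed) (hZ : z'.fZ = z.fZ)
    (hR : z'.fR = z.fR) (hd : z.defined ⊆ z'.defined)
    (hc : ∀ c ∈ z'.conds, c.2.1.vars ⊆ z'.defined)
    (hf : Disjoint (P.future z'.label) z'.defined) : z'.WellFormed where
  measurable_solve := solve_congr hZ hR ▸ hz.measurable_solve
  determines_iff := by
    rw [solve_congr hZ hR, determines_congr hZ hR]; exact hz.determines_iff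
  fZ_vars x e h := (hz.fZ_vars x e (hZ ▸ h)).trans hd
  fR_vars x e h := (hz.fR_vars x e (hR ▸ h)).trans hd
  conds_vars := hc
  future := hf

end DState

/-! ### Sums against mass functions and the form of the one-step simulation -/

theorem lintegral_toMeasure {α : Type} [Countable α] [MeasurableSpace α]
    [MeasurableSingletonClass α] (p : PMF α) (f : α → ℝ≥0∞) :
    ∫⁻ a, f a ∂p.toMeasure = ∑' a, p a * f a := by
  rw [lintegral_countable']
  exact tsum_congr fun a => by
    rw [p.toMeasure_apply_singleton _ (measurableSet_singleton a), mul_comm]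

theorem tsum_map_mul {α β : Type} (p : PMF α) (g : α → β) (f : β → ℝ≥0∞) :
    ∑' b, p.map g b * f b = ∑' a, p a * f (g a) := by
  classical
  simp only [PMF.map_apply, ← ENNReal.tsum_mul_right]
  rw [ENNReal.tsum_comm]
  refine tsum_congr fun a => ?_
  rw [tsum_eq_single (g a) fun b hb => by simp [hb]]
  simp

theorem tsum_pure_mul {β : Type} (b₀ : β) (f : β → ℝ≥0∞) : ∑' b, PMF.pure b₀ b * f b = f b₀ := by
  classical
  rw [tsum_eq_single b₀ fun b hb => by simp [PMF.pure_apply, hb]]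
  simp

theorem Program.assignsAt_eq (P : Program σ) {l : σ.Label} {a : Asgn σ} {n : σ.Label}
    (h : P.instr l = .asgn a n) : {v | P.AssignsAt l v} = {a.target} := by
  ext v
  simp only [AssignsAt, h, Set.mem_ofPred_eq, Set.mem_singleton_iff]
  constructor
  · rintro ⟨a', n', h, rfl⟩
    cases h
    rfl
  · rintro rfl
    exact ⟨a, n, rfl, rfl⟩

namespace DState

variable {P : Program σ}

/-- The conditions on a successor state that allow the simulation to go on. -/
structure IsSuccessor (ε : PosReal) (z z' : DState P) : Prop where
  wellFormed : z'.WellFormed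
  weight_ne_zero : z'.weight ε ≠ 0
  defined_eq : z'.defined = z.defined ∪ {v | P.AssignsAt z.label v}

/-- The simulation of one step of the Markov kernel semantics by the DTMC semantics. -/
def Simulates (ε : PosReal) (z : DState P) : Prop :=
  (∀ z', z.step ε z' ≠ 0 → z.IsSuccessor ε z') ∧
    ∀ f : NState σ → ℝ≥0∞, Measurable f →
      z.expect ε (fun s => ∫⁻ s', f s' ∂(P.natStep ε s)) = ∑' z', z.step ε z' * z'.expect ε f

/-- This covers the Laplace samplings too: the DTMC only records the parameters, and the randomness
of the kernel step is absorbed into the value law of `z'`. -/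
theorem simulates_of_pure {ε : PosReal} {z z' : DState P} (h : z.step ε = PMF.pure z')
    (hz' : z.IsSuccessor ε z') (hf : ∀ f : NState σ → ℝ≥0∞, Measurable f →
      z.expect ε (fun s => ∫⁻ s', f s' ∂(P.natStep ε s)) = z'.expect ε f) : z.Simulates ε := by
  classical
  refine ⟨fun z'' h0 => ?_, fun f hm => ?_⟩
  · rw [h, PMF.pure_apply] at h0
    obtain rfl : z'' = z' := by by_contra hne; exact h0 (if_neg hne)
    exact hz'
  · rw [hf f hm, h, tsum_pure_mul]

/-- For the statements at which the DTMC itself branches: `DOM` samplings and comparisons. -/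
theorem simulates_of_map {ε : PosReal} {z : DState P} {α : Type} {p : PMF α} {g : α → DState P}
    (h : z.step ε = p.map g) (hz' : ∀ d, p d ≠ 0 → z.IsSuccessor ε (g d))
    (hf : ∀ f : NState σ → ℝ≥0∞, Measurable f →
      z.expect ε (fun s => ∫⁻ s', f s' ∂(P.natStep ε s)) = ∑' d, p d * (g d).expect ε f) :
    z.Simulates ε := by
  classical
  refine ⟨fun z'' h0 => ?_, fun f hm => ?_⟩
  · rw [h, ← PMF.mem_support_iff, PMF.mem_support_map_iff] at h0
    obtain ⟨d, hd, rfl⟩ := h0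
    exact hz' d hd
  · rw [hf f hm, h, tsum_map_mul]

theorem defined_setBool (z : DState P) (n : σ.Label) (b : σ.BVar) (t : Bool)
    (C : Set (Bool × P.bExp)) :
    ({ z with label := n, fB := Function.update z.fB b (some t), conds := C } : DState P).defined =
      insert (.bool b) z.defined := by
  ext v
  rcases v with b' | x | x | x <;> simp only [Set.mem_insert_iff, bool_mem_defined,
    dom_mem_defined, int_mem_defined, real_mem_defined, Function.update_apply, reduceCtorEq,
    false_or, Var.bool.injEq]
  split_ifs with h <;> simp [h]

theorem defined_setDom (z : DState P) (n : σ.Label) (x : σ.XVar) (d : σ.Dom) :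
    ({ z with label := n, fX := Function.update z.fX x (some d) } : DState P).defined =
      insert (.dom x) z.defined := by
  ext v
  rcases v with b' | x | x | x <;> simp only [Set.mem_insert_iff, bool_mem_defined,
    dom_mem_defined, int_mem_defined, real_mem_defined, Function.update_apply, reduceCtorEq,
    false_or, Var.dom.injEq]
  split_ifs with h <;> simp [h]

theorem defined_setInt (z : DState P) (n : σ.Label) (x : σ.ZVar) (A) :
    ({ z with label := n, fZ := Function.update z.fZ x (some A) } : DState P).defined =
      insert (.int x) z.defined := by
  ext v
  rcases v with b' | x | x | x <;> simp only [Set.mem_insert_iff, bool_mem_defined,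
    dom_mem_defined, int_mem_defined, real_mem_defined, Function.update_apply, reduceCtorEq,
    false_or, Var.int.injEq]
  split_ifs with h <;> simp [h]

theorem defined_setReal (z : DState P) (n : σ.Label) (x : σ.RVar) (A) :
    ({ z with label := n, fR := Function.update z.fR x (some A) } : DState P).defined =
      insert (.real x) z.defined := by
  ext v
  rcases v with b' | x | x | x <;> simp only [Set.mem_insert_iff, bool_mem_defined,
    dom_mem_defined, int_mem_defined, real_mem_defined, Function.update_apply, reduceCtorEq,
    false_or, Var.real.injEq]
  split_ifs with h <;> simp [h]

theorem boolVal_update (z : DState P) (n : σ.Label) (b : σ.BVar) (t : Bool)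
    (C : Set (Bool × P.bExp)) :
    ({ z with label := n, fB := Function.update z.fB b (some t), conds := C } : DState P).boolVal =
      Function.update z.boolVal b t := by
  funext b'
  by_cases h : b' = b
  · subst h; simp [boolVal]
  · simp [boolVal, h]

theorem domVal_update (z : DState P) (n : σ.Label) (x : σ.XVar) (d : σ.Dom) :
    ({ z with label := n, fX := Function.update z.fX x (some d) } : DState P).domVal =
      Function.update z.domVal x d := by
  funext b'
  by_cases h : b' = x
  · subst h; simp [domVal]
  · simp [domVal, h]

theorem weight_congr {z z' : DState P} (ε : PosReal) (hZ : z'.fZ = z.fZ) (hR : z'.fR = z.fR)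
    (hc : z'.conds = z.conds) : z'.weight ε = z.weight ε := by
  rw [weight, weight, valueLaw_congr ε hZ hR, hc]

theorem expect_congr {z z' : DState P} (ε : PosReal) (hZ : z'.fZ = z.fZ) (hR : z'.fR = z.fR)
    (hc : z'.conds = z.conds) (f : NState σ → ℝ≥0∞) :
    z'.expect ε f = (z.weight ε)⁻¹ * ∫⁻ v in sat z.conds, f (z'.toNState v) ∂(z.valueLaw ε) := by
  rw [expect, weight_congr ε hZ hR hc, valueLaw_congr ε hZ hR, hc]

theorem isSuccessor_of_assign (hP : P.IsDiPWhile) {ε : PosReal} {z z' : DState P}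
    (hz : z.WellFormed) (hw : z.weight ε ≠ 0) {a : Asgn σ} (hi : P.instr z.label = .asgn a z'.label)
    (hZ : z'.fZ = z.fZ) (hR : z'.fR = z.fR) (hc : z'.conds = z.conds)
    (hd : z'.defined = insert a.target z.defined) : z.IsSuccessor ε z' where
  wellFormed := by
    have hsub : z.defined ⊆ z'.defined := hd ▸ Set.subset_insert _ _
    refine hz.congr hZ hR hsub ?_ (disjoint_future_of_assign hP hz hi hd)
    rw [hc]
    exact fun c h => (hz.conds_vars c h).trans hsub
  weight_ne_zero := by rwa [weight_congr ε hZ hR hc]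
  defined_eq := by rw [hd, P.assignsAt_eq hi, Set.union_singleton]

/-- The law of the sample does not depend on the integer and real values, and sampling leaves their
law and the conditions alone. Hence the sum over outcomes can be exchanged with the integral. -/
theorem expect_sampling {z : DState P} {ε : PosReal} {α : Type} [Countable α] [MeasurableSpace α]
    [DiscreteMeasurableSpace α] (p : PMF α) (g : α → DState P) (hZ : ∀ d, (g d).fZ = z.fZ)
    (hR : ∀ d, (g d).fR = z.fR) (hc : ∀ d, (g d).conds = z.conds) {f : NState σ → ℝ≥0∞}
    (hf : Measurable f)
    (hs : ∀ v, P.natStep ε (z.toNState v) = p.toMeasure.map fun d => (g d).toNState v) :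
    z.expect ε (fun s => ∫⁻ s', f s' ∂(P.natStep ε s)) = ∑' d, p d * (g d).expect ε f := by
  have h1 : ∀ v, ∫⁻ s', f s' ∂(P.natStep ε (z.toNState v)) = ∑' d, p d * f ((g d).toNState v) := by
    intro v
    rw [hs, lintegral_map hf Measurable.of_discrete, lintegral_toMeasure]
  simp only [expect_congr ε (hZ _) (hR _) (hc _)]
  rw [expect]
  simp only [h1]
  have hm : ∀ d, Measurable fun v => f ((g d).toNState v) := fun d =>
    hf.comp (g d).measurable_toNState
  rw [lintegral_tsum fun d => ((hm d).const_mul _).aemeasurable, ← ENNReal.tsum_mul_left]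
  refine tsum_congr fun d => ?_
  rw [lintegral_const_mul _ (hm d)]
  ring

theorem expect_dirac {z z' : DState P} {ε : PosReal} (hZ : z'.fZ = z.fZ) (hR : z'.fR = z.fR)
    (hc : z'.conds = z.conds) {f : NState σ → ℝ≥0∞} (hf : Measurable f)
    (hs : ∀ v, P.natStep ε (z.toNState v) = Measure.dirac (z'.toNState v)) :
    z.expect ε (fun s => ∫⁻ s', f s' ∂(P.natStep ε s)) = z'.expect ε f := by
  rw [expect_congr ε hZ hR hc, expect]
  simp only [hs, lintegral_dirac' _ hf]

theorem natStep_toNState (ε : PosReal) {z : DState P} {a : Asgn σ} {n : σ.Label}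
    (h : P.instr z.label = .asgn a n) (v : Vals σ) :
    P.natStep ε (z.toNState v) =
      a.natStep ε n ((z.label, z.boolVal, z.domVal, v.1), v.2) := by
  unfold Program.natStep
  rw [show P.instr (z.toNState v).1.1 = .asgn a n from h]
  rfl

end DState

/-! ### Simulation of the individual statements -/

namespace DState

variable {P : Program σ}

theorem simulates_branch (hP : P.IsDiPWhile) {ε : PosReal} {z : DState P} (hz : z.WellFormed)
    (hw : z.weight ε ≠ 0) {c : BExp σ} {l₁ l₂ : σ.Label} (hi : P.instr z.label = .branch c l₁ l₂) :
    z.Simulates ε := by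
  set z' : DState P := { z with label := if c.eval z.boolVal z.domVal then l₁ else l₂ } with hz'
  have hstep : z.step ε = PMF.pure z' := by
    unfold step
    split <;> rename_i h <;> rw [hi] at h <;> cases h
    rfl
  have hsucc : z'.label ∈ (P.instr z.label).succs := by
    simp only [hi, Instr.succs, hz']
    split_ifs <;> simp
  refine simulates_of_pure hstep ⟨?_, ?_, ?_⟩ fun f hf =>
    expect_dirac (by rfl) (by rfl) (by rfl) hf fun v => ?_
  · exact hz.congr rfl rfl subset_rfl hz.conds_vars
      (Set.disjoint_of_subset_left (hP.future_succ _ hsucc).1 hz.future)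
  · exact hw
  · have : {v | P.AssignsAt z.label v} = ∅ := by
      ext v
      simp [Program.AssignsAt, hi]
    rw [this, Set.union_empty]
    rfl
  · unfold Program.natStep
    rw [show P.instr (z.toNState v).1.1 = _ from hi]
    rfl

theorem simulates_dom (hP : P.IsDiPWhile) {ε : PosReal} {z : DState P} (hz : z.WellFormed)
    (hw : z.weight ε ≠ 0) {x : σ.XVar} {e : DExp σ} {n : σ.Label}
    (hi : P.instr z.label = .asgn (.dom x e) n) : z.Simulates ε := by
  have hstep : z.step ε = PMF.pure { z with
      label := n, fX := Function.update z.fX x (some (e.eval z.domVal)) } := by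
    unfold step
    split <;> rename_i h <;> rw [hi] at h <;> cases h
    rfl
  refine simulates_of_pure hstep
    (isSuccessor_of_assign hP hz hw hi rfl rfl rfl (defined_setDom z n x _))
    fun f hf => expect_dirac (by rfl) (by rfl) (by rfl) hf fun v => ?_
  rw [natStep_toNState ε hi, toNState, domVal_update]
  rfl

theorem simulates_bool (hP : P.IsDiPWhile) {ε : PosReal} {z : DState P} (hz : z.WellFormed)
    (hw : z.weight ε ≠ 0) {b : σ.BVar} {e : BExp σ} {n : σ.Label}
    (hi : P.instr z.label = .asgn (.bool b e) n) : z.Simulates ε := by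
  have hstep : z.step ε = PMF.pure { z with
      label := n, fB := Function.update z.fB b (some (e.eval z.boolVal z.domVal)) } := by
    unfold step
    split <;> rename_i h <;> rw [hi] at h <;> cases h
    rfl
  refine simulates_of_pure hstep
    (isSuccessor_of_assign hP hz hw hi rfl rfl rfl (defined_setBool z n b _ _))
    fun f hf => expect_dirac (by rfl) (by rfl) (by rfl) hf fun v => ?_
  rw [natStep_toNState ε hi, toNState, boolVal_update]
  rfl

theorem simulates_expo (hP : P.IsDiPWhile) {ε : PosReal} {z : DState P} (hz : z.WellFormed)
    (hw : z.weight ε ≠ 0) {x : σ.XVar} {a : PosRat} {k : ℕ}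
    {F : (Fin k → σ.Dom) → σ.Dom → σ.Dom → ℚ} {xs : Fin k → σ.XVar} {e : DExp σ} {n : σ.Label}
    (hi : P.instr z.label = .asgn (.expo x a F xs e) n) : z.Simulates ε := by
  have hstep : z.step ε =
      (expMech (scale a ε) (F (fun i => z.domVal (xs i)) (e.eval z.domVal))).map fun d =>
        { z with label := n, fX := Function.update z.fX x (some d) } := by
    unfold step
    split <;> rename_i h <;> rw [hi] at h <;> cases h
    rfl
  refine simulates_of_map hstep
    (fun d _ => isSuccessor_of_assign hP hz hw hi rfl rfl rfl (defined_setDom z n x _))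
    fun f hf => expect_sampling _ _ (by intro; rfl) (by intro; rfl) (by intro; rfl) hf fun v => ?_
  rw [natStep_toNState ε hi]
  simp only [toNState, domVal_update]
  rfl

theorem simulates_choose (hP : P.IsDiPWhile) {ε : PosReal} {z : DState P} (hz : z.WellFormed)
    (hw : z.weight ε ≠ 0) {x : σ.XVar} {a : PosRat} {k : ℕ}
    {D : PosReal → (Fin k → σ.Dom) → PMF σ.Dom} {es : Fin k → DExp σ} {n : σ.Label}
    (hi : P.instr z.label = .asgn (.choose x a D es) n) : z.Simulates ε := by
  have hstep : z.step ε = (D (scale a ε) fun i => (es i).eval z.domVal).map fun d =>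
        { z with label := n, fX := Function.update z.fX x (some d) } := by
    unfold step
    split <;> rename_i h <;> rw [hi] at h <;> cases h
    rfl
  refine simulates_of_map hstep
    (fun d _ => isSuccessor_of_assign hP hz hw hi rfl rfl rfl (defined_setDom z n x _))
    fun f hf => expect_sampling _ _ (by intro; rfl) (by intro; rfl) (by intro; rfl) hf fun v => ?_
  rw [natStep_toNState ε hi]
  simp only [toNState, domVal_update]
  rfl

theorem simulates_int (hP : P.IsDiPWhile) {ε : PosReal} {z : DState P} (hz : z.WellFormed)
    (hw : z.weight ε ≠ 0) {x : σ.ZVar} {e : IExp σ} {n : σ.Label}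
    (hi : P.instr z.label = .asgn (.int x e) n) (hr : e.vars ⊆ z.defined) : z.Simulates ε := by
  -- The right-hand side reads only variables that have a value, and `x` has none; so the new
  -- equation for `x` is explicit rather than circular.
  have hnx : .int x ∉ e.vars := fun h => Set.disjoint_left.mp hz.future
    (hP.numTarget_subset z.label (by rw [hi]; exact ⟨rfl, trivial⟩)) (hr h)
  have hstep : z.step ε = PMF.pure { z with
      label := n
      fZ := Function.update z.fZ x
        (some (.inl ⟨e.peval z.domVal, z.label, x, e, n, z.domVal, hi, rfl⟩)) } := by
    unfold step
    split <;> rename_i h <;> rw [hi] at h <;> cases h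
    rfl
  have hdef := defined_setInt z n x
    (.inl ⟨e.peval z.domVal, z.label, x, e, n, z.domVal, hi, rfl⟩)
  generalize hz' : ({ z with
      label := n
      fZ := Function.update z.fZ x
        (some (.inl ⟨e.peval z.domVal, z.label, x, e, n, z.domVal, hi, rfl⟩)) } : DState P) = z'
    at hstep hdef
  have hi' : P.instr z.label = .asgn (.int x e) z'.label := by subst hz'; exact hi
  have hfx : z'.fZ x = some (.inl ⟨e.peval z.domVal, z.label, x, e, n, z.domVal, hi, rfl⟩) := by
    subst hz'; simp
  have hnoise : z'.intNoise ε x = Measure.dirac 0 := by unfold intNoise; rw [hfx]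
  obtain ⟨h1, h2, h3⟩ := setInt_spec hP hz (z' := z') (r := x) ε hi' rfl hdef
    (by subst hz'; rfl) (by rintro y hy; subst hz'; simp [hy]) (by subst hz'; rfl)
    (by
      rintro e' he'
      rw [hfx] at he'
      cases he'
      exact (e.vars_peval _).trans hr)
    -- The sample at `x` plays no role: the new value is computed from the old values.
    (h := fun _ v => e.eval z.domVal v.1) ((e.measurable_eval_vals _).comp measurable_fst)
    (fun _ v y => e.eval_setInt _ hnx v y)
    (fun ω v => by simp only [hfx, IExp.eval_peval])
  refine simulates_of_pure hstep ⟨h1, h2 ▸ hw, by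
    rw [hdef, P.assignsAt_eq hi, Set.union_singleton]; rfl⟩ fun f hf => ?_
  rw [h3 f hf, expect]
  refine congrArg _ (lintegral_congr fun v => ?_)
  rw [natStep_toNState ε hi, hnoise, lintegral_dirac]
  refine (lintegral_dirac' _ hf).trans ?_
  subst hz'
  rfl

theorem simulates_real (hP : P.IsDiPWhile) {ε : PosReal} {z : DState P} (hz : z.WellFormed)
    (hw : z.weight ε ≠ 0) {x : σ.RVar} {e : RExp σ} {n : σ.Label}
    (hi : P.instr z.label = .asgn (.real x e) n) (hr : e.vars ⊆ z.defined) : z.Simulates ε := by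
  have hnx : .real x ∉ e.vars := fun h => Set.disjoint_left.mp hz.future
    (hP.numTarget_subset z.label (by rw [hi]; exact ⟨rfl, trivial⟩)) (hr h)
  have hstep : z.step ε = PMF.pure { z with
      label := n
      fR := Function.update z.fR x
        (some (.inl ⟨e.peval z.domVal, z.label, x, e, n, z.domVal, hi, rfl⟩)) } := by
    unfold step
    split <;> rename_i h <;> rw [hi] at h <;> cases h
    rfl
  have hdef := defined_setReal z n x
    (.inl ⟨e.peval z.domVal, z.label, x, e, n, z.domVal, hi, rfl⟩)
  generalize hz' : ({ z with
      label := n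
      fR := Function.update z.fR x
        (some (.inl ⟨e.peval z.domVal, z.label, x, e, n, z.domVal, hi, rfl⟩)) } : DState P) = z'
    at hstep hdef
  have hi' : P.instr z.label = .asgn (.real x e) z'.label := by subst hz'; exact hi
  have hfx : z'.fR x = some (.inl ⟨e.peval z.domVal, z.label, x, e, n, z.domVal, hi, rfl⟩) := by
    subst hz'; simp
  have hnoise : z'.realNoise ε x = Measure.dirac 0 := by unfold realNoise; rw [hfx]
  obtain ⟨h1, h2, h3⟩ := setReal_spec hP hz (z' := z') (r := x) ε hi' rfl hdef
    (by subst hz'; rfl) (by rintro y hy; subst hz'; simp [hy]) (by subst hz'; rfl)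
    (by
      rintro e' he'
      rw [hfx] at he'
      cases he'
      exact (e.vars_peval _).trans hr)
    (h := fun _ v => e.eval z.domVal v.2) ((e.measurable_eval_vals _).comp measurable_fst)
    (fun _ v y => e.eval_setReal _ hnx v y)
    (fun ω v => by simp only [hfx, RExp.eval_peval])
  refine simulates_of_pure hstep ⟨h1, h2 ▸ hw, by
    rw [hdef, P.assignsAt_eq hi, Set.union_singleton]; rfl⟩ fun f hf => ?_
  rw [h3 f hf, expect]
  refine congrArg _ (lintegral_congr fun v => ?_)
  rw [natStep_toNState ε hi, hnoise, lintegral_dirac]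
  refine (lintegral_dirac' _ hf).trans ?_
  subst hz'
  rfl

theorem simulates_dLap (hP : P.IsDiPWhile) {ε : PosReal} {z : DState P} (hz : z.WellFormed)
    (hw : z.weight ε ≠ 0) {x : σ.ZVar} {a : PosRat} {e : DExp σ} {n : σ.Label}
    (hi : P.instr z.label = .asgn (.dLap x a e) n) : z.Simulates ε := by
  have hstep : z.step ε = PMF.pure { z with
      label := n
      fZ := Function.update z.fZ x
        (some (.inr (⟨a, Or.inl ⟨z.label, x, e, n, hi⟩⟩, e.eval z.domVal))) } := by
    unfold step
    split <;> rename_i h <;> rw [hi] at h <;> cases h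
    rfl
  have hdef := defined_setInt z n x (.inr (⟨a, Or.inl ⟨z.label, x, e, n, hi⟩⟩, e.eval z.domVal))
  generalize hz' : ({ z with
      label := n
      fZ := Function.update z.fZ x
        (some (.inr (⟨a, Or.inl ⟨z.label, x, e, n, hi⟩⟩, e.eval z.domVal))) } : DState P) = z'
    at hstep hdef
  have hi' : P.instr z.label = .asgn (.dLap x a e) z'.label := by subst hz'; exact hi
  have hfx : z'.fZ x = some (.inr (⟨a, Or.inl ⟨z.label, x, e, n, hi⟩⟩, e.eval z.domVal)) := by
    subst hz'; simp
  have hnoise : z'.intNoise ε x = (DP.dLap (scale a ε) (e.eval z.domVal : ℤ)).toMeasure := by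
    unfold intNoise; rw [hfx]
  obtain ⟨h1, h2, h3⟩ := setInt_spec hP hz (z' := z') (r := x) ε hi' rfl hdef
    (by subst hz'; rfl) (by rintro y hy; subst hz'; simp [hy]) (by subst hz'; rfl)
    (by
      rintro e' he'
      rw [hfx] at he'
      cases he')
    -- Here the new value is the sample itself.
    (h := fun y _ => y) measurable_snd (fun _ _ _ => rfl) (fun ω v => by simp only [hfx])
  refine simulates_of_pure hstep ⟨h1, h2 ▸ hw, by
    rw [hdef, P.assignsAt_eq hi, Set.union_singleton]; rfl⟩ fun f hf => ?_
  rw [h3 f hf, expect]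
  refine congrArg _ (lintegral_congr fun v => ?_)
  rw [natStep_toNState ε hi, hnoise]
  refine (lintegral_map hf Measurable.of_discrete).trans ?_
  subst hz'
  rfl

theorem simulates_lap (hP : P.IsDiPWhile) {ε : PosReal} {z : DState P} (hz : z.WellFormed)
    (hw : z.weight ε ≠ 0) {x : σ.RVar} {a : PosRat} {e : DExp σ} {n : σ.Label}
    (hi : P.instr z.label = .asgn (.lap x a e) n) : z.Simulates ε := by
  have hstep : z.step ε = PMF.pure { z with
      label := n
      fR := Function.update z.fR x
        (some (.inr (⟨a, Or.inr ⟨z.label, x, e, n, hi⟩⟩, e.eval z.domVal))) } := by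
    unfold step
    split <;> rename_i h <;> rw [hi] at h <;> cases h
    rfl
  have hdef := defined_setReal z n x (.inr (⟨a, Or.inr ⟨z.label, x, e, n, hi⟩⟩, e.eval z.domVal))
  generalize hz' : ({ z with
      label := n
      fR := Function.update z.fR x
        (some (.inr (⟨a, Or.inr ⟨z.label, x, e, n, hi⟩⟩, e.eval z.domVal))) } : DState P) = z'
    at hstep hdef
  have hi' : P.instr z.label = .asgn (.lap x a e) z'.label := by subst hz'; exact hi
  have hfx : z'.fR x = some (.inr (⟨a, Or.inr ⟨z.label, x, e, n, hi⟩⟩, e.eval z.domVal)) := by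
    subst hz'; simp
  have hnoise : z'.realNoise ε x = DP.lap (scale a ε) ((e.eval z.domVal : ℤ) : ℝ) := by
    unfold realNoise; rw [hfx]
  obtain ⟨h1, h2, h3⟩ := setReal_spec hP hz (z' := z') (r := x) ε hi' rfl hdef
    (by subst hz'; rfl) (by rintro y hy; subst hz'; simp [hy]) (by subst hz'; rfl)
    (by
      rintro e' he'
      rw [hfx] at he'
      cases he')
    (h := fun y _ => y) measurable_snd (fun _ _ _ => rfl) (fun ω v => by simp only [hfx])
  refine simulates_of_pure hstep ⟨h1, h2 ▸ hw, by
    rw [hdef, P.assignsAt_eq hi, Set.union_singleton]; rfl⟩ fun f hf => ?_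
  rw [h3 f hf, expect]
  refine congrArg _ (lintegral_congr fun v => ?_)
  rw [natStep_toNState ε hi, hnoise]
  refine (lintegral_map hf (measurable_const.prodMk (measurable_update _))).trans ?_
  subst hz'
  rfl

theorem sat_insert (C : Set (Bool × P.bExp)) (t : Bool) (c : P.bExp) :
    sat (insert (t, c) C) = sat C ∩ {v | c.1.eval (fun _ => 0) v.1 v.2 = t} := by
  ext v
  simp only [sat, Set.mem_insert_iff, forall_eq_or_imp, Set.mem_ofPred_eq, Set.mem_inter_iff]
  exact and_comm

/-- Positive weight rules out the default value `0` in `condProb`. The two outcomes partition the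
event of the old conditions, so `1 - p` is again a ratio of weights. -/
theorem coin_condProb {z : DState P} (hz : z.WellFormed) {ε : PosReal} (hw : z.weight ε ≠ 0)
    (c : P.bExp) (t : Bool) : coin (z.condProb ε c) (z.condProb_le_one ε c) t =
      z.valueLaw ε (sat (insert (t, c) z.conds)) * (z.weight ε)⁻¹ := by
  have := hz.isProbabilityMeasure ε
  have hp : z.condProb ε c = z.valueLaw ε (sat (insert (true, c) z.conds)) * (z.weight ε)⁻¹ := by
    unfold condProb
    rw [hz.noise_event, hz.noise_event, if_neg (by exact hw), div_eq_mul_inv]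
    rfl
  have hsum : z.valueLaw ε (sat (insert (true, c) z.conds)) +
      z.valueLaw ε (sat (insert (false, c) z.conds)) = z.weight ε := by
    rw [sat_insert, sat_insert, weight, ← measure_inter_add_sdiff (sat z.conds)
      (c.1.measurable_eval_vals (fun _ => 0) (measurableSet_singleton true))]
    congr 2
    ext v
    simp
  have hfin : z.weight ε ≠ ∞ := measure_ne_top _ _
  have hne : z.valueLaw ε (sat (insert (true, c) z.conds)) * (z.weight ε)⁻¹ ≠ ∞ :=
    ENNReal.mul_ne_top (measure_ne_top _ _) (ENNReal.inv_ne_top.mpr hw)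
  cases t
  · change 1 - z.condProb ε c = _
    rw [hp]
    refine ENNReal.sub_eq_of_eq_add hne ?_
    rw [← add_mul, add_comm, hsum, ENNReal.mul_inv_cancel hw hfin]
  · exact hp

/-- Law of total probability: the kernel stores the truth value of the comparison in `b`, this value
is constant on each of the two parts of the event, and the DTMC chooses a part with its conditional
probability. -/
theorem simulates_cmp (hP : P.IsDiPWhile) {ε : PosReal} {z : DState P} (hz : z.WellFormed)
    (hw : z.weight ε ≠ 0) {b : σ.BVar} {c : CExp σ} {n : σ.Label}
    (hi : P.instr z.label = .asgn (.cmp b c) n) (hr : c.vars ⊆ z.defined) : z.Simulates ε := by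
  set c' : P.bExp := ⟨c.peval z.domVal, z.label, b, c, n, z.domVal, hi, rfl⟩ with hc'
  set g : Bool → DState P := fun t => { z with
    label := n
    fB := Function.update z.fB b (some t)
    conds := insert (t, c') z.conds }
  have hstep : z.step ε = (coin (z.condProb ε c') (z.condProb_le_one ε c')).map g := by
    unfold step
    split <;> rename_i h <;> rw [hi] at h <;> cases h
    rfl
  have := hz.isProbabilityMeasure ε
  have hdef : ∀ t, (g t).defined = insert (.bool b) z.defined := fun t =>
    defined_setBool z n b t (insert (t, c') z.conds)
  have hlaw : ∀ t, (g t).valueLaw ε = z.valueLaw ε := fun t => valueLaw_congr ε rfl rfl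
  have hweight : ∀ t, (g t).weight ε = z.valueLaw ε (sat (insert (t, c') z.conds)) := fun t => by
    rw [weight, hlaw]
  refine simulates_of_map hstep (fun t ht => ⟨?_, ?_, ?_⟩) fun f hf => ?_
  · have hsub : z.defined ⊆ (g t).defined := hdef t ▸ Set.subset_insert _ _
    refine hz.congr rfl rfl hsub ?_ (disjoint_future_of_assign hP hz hi (hdef t))
    rintro d (rfl | hd)
    · exact (c.vars_peval _).trans (hr.trans hsub)
    · exact (hz.conds_vars d hd).trans hsub
  · rw [coin_condProb hz hw] at ht
    rw [hweight]
    -- A branch taken with positive probability has conditions of positive weight, so the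
    -- normalisation in `expect` remains legitimate.
    exact left_ne_zero_of_mul ht
  · rw [hdef, P.assignsAt_eq hi, Set.union_singleton]; rfl
  · have hnat : ∀ v, ∫⁻ s', f s' ∂(P.natStep ε (z.toNState v)) =
        f ((g (c'.1.eval (fun _ => 0) v.1 v.2)).toNState v) := by
      intro v
      rw [natStep_toNState ε hi]
      refine (lintegral_dirac' _ hf).trans ?_
      rw [toNState, boolVal_update, hc', CExp.eval_peval]
      rfl
    -- The probability of the branch has the weight of the new conditions as numerator, and `expect`
    -- divides by it; after cancellation only the old weight remains.
    have hterm : ∀ t, coin (z.condProb ε c') (z.condProb_le_one ε c') t * (g t).expect ε f =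
        (z.weight ε)⁻¹ * ∫⁻ v in sat (insert (t, c') z.conds),
          f ((g (c'.1.eval (fun _ => 0) v.1 v.2)).toNState v) ∂(z.valueLaw ε) := by
      intro t
      have hcongr : ∫⁻ v in sat (insert (t, c') z.conds),
          f ((g (c'.1.eval (fun _ => 0) v.1 v.2)).toNState v) ∂(z.valueLaw ε) =
          ∫⁻ v in sat (insert (t, c') z.conds), f ((g t).toNState v) ∂(z.valueLaw ε) := by
        refine setLIntegral_congr_fun (measurableSet_sat _) fun v hv => ?_
        rw [sat_insert] at hv
        simp only [show c'.1.eval (fun _ => 0) v.1 v.2 = t from hv.2]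
      rw [hcongr, coin_condProb hz hw, expect, hweight, hlaw]
      -- A branch of weight zero contributes nothing on either side, although its `expect` is not
      -- normalised.
      by_cases h0 : z.valueLaw ε (sat (insert (t, c') z.conds)) = 0
      · rw [h0, Measure.restrict_eq_zero.mpr h0]
        simp
      · change _ * (z.weight ε)⁻¹ * (_ * ∫⁻ v in sat (insert (t, c') z.conds), _ ∂_) = _
        rw [mul_comm _ (z.weight ε)⁻¹, mul_assoc, ← mul_assoc _ _⁻¹,
          ENNReal.mul_inv_cancel h0 (measure_ne_top _ _), one_mul]
    rw [tsum_fintype, Fintype.sum_bool, hterm, hterm, ← mul_add, expect]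
    simp only [hnat]
    rw [← lintegral_inter_add_sdiff _ (sat z.conds)
      (c'.1.measurable_eval_vals (fun _ => 0) (measurableSet_singleton true)), sat_insert,
      sat_insert]
    congr 4
    ext v
    simp

/-- One step of the Markov kernel semantics is simulated by the DTMC semantics, if the variables
that are referred to have values. -/
theorem simulates (hP : P.IsDiPWhile) {ε : PosReal} {z : DState P} (hz : z.WellFormed)
    (hw : z.weight ε ≠ 0) (he : ¬ P.IsExit z.label) (hr : P.readsAt z.label ⊆ z.defined) :
    z.Simulates ε := by
  unfold Program.readsAt at hr
  rcases hi : P.instr z.label with _ | ⟨a, n⟩ | ⟨c, l₁, l₂⟩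
  · exact absurd hi he
  · simp only [hi] at hr
    -- The hypothesis on reads enters only when integer or real variables are read. Boolean and
    -- `DOM` variables without a value have the same defaults in both semantics.
    cases a with
    | dom x e => exact simulates_dom hP hz hw hi
    | expo x a F xs e => exact simulates_expo hP hz hw hi
    | choose x a D es => exact simulates_choose hP hz hw hi
    | int z e => exact simulates_int hP hz hw hi hr
    | dLap z a e => exact simulates_dLap hP hz hw hi
    | real r e => exact simulates_real hP hz hw hi hr
    | lap r a e => exact simulates_lap hP hz hw hi
    | bool b e => exact simulates_bool hP hz hw hi
    | cmp b c => exact simulates_cmp hP hz hw hi hr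
  · exact simulates_branch hP hz hw hi

end DState

/-! ### The initial state -/

theorem pi_dirac {ι α : Type} [Fintype ι] [MeasurableSpace α] (x : α) :
    Measure.pi (fun _ : ι => Measure.dirac x) = Measure.dirac fun _ => x := by
  classical
  refine Measure.pi_eq fun s hs => ?_
  rw [Measure.dirac_apply' _ (MeasurableSet.univ_pi hs)]
  simp only [Measure.dirac_apply' _ (hs _), Set.indicator_apply, Pi.one_apply, Finset.prod_boole,
    Set.mem_univ_pi, Finset.mem_univ, true_imp_iff]

namespace DState

variable {P : Program σ}

theorem expect_const {z : DState P} (hz : z.WellFormed) {ε : PosReal} (hw : z.weight ε ≠ 0)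
    (c : ℝ≥0∞) : z.expect ε (fun _ => c) = c := by
  have := hz.isProbabilityMeasure ε
  rw [expect, setLIntegral_const, mul_comm c, ← mul_assoc]
  change _ * z.weight ε * c = c
  rw [ENNReal.inv_mul_cancel hw (measure_ne_top _ _), one_mul]

end DState

namespace Program

variable (P : Program σ)

theorem dtmcInit_solve (inp : P.InVal) : (P.dtmcInit inp).solve = id := by
  refine DState.solve_eq fun ω v => ?_
  simp only [DState.Determines, dtmcInit, id]
  rw [Prod.ext_iff, funext_iff, funext_iff]

theorem defined_dtmcInit (inp : P.InVal) : (P.dtmcInit inp).defined = P.assignedIn ∅ := by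
  ext v
  rcases v with x | x | x | x <;> simp [dtmcInit, assignedIn]

theorem wellFormed_dtmcInit (inp : P.InVal) : (P.dtmcInit inp).WellFormed where
  measurable_solve := by rw [dtmcInit_solve]; exact measurable_id
  determines_iff ω v := by
    rw [dtmcInit_solve]
    simp only [DState.Determines, dtmcInit, id]
    rw [Prod.ext_iff, funext_iff, funext_iff]
  fZ_vars x e h := by simp [dtmcInit] at h
  fR_vars x e h := by simp [dtmcInit] at h
  conds_vars c h := by simp [dtmcInit] at h
  future := by
    rw [Set.disjoint_left]
    intro v hv hd
    -- Only input variables have a value initially, and these are `DOM` variables, whereas a future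
    -- is purely numeric.
    have hn := P.body.isNumeric_of_mem_numAssigned (P.body.future_subset _ hv)
    rcases v with x | x | x | x
    · exact hn
    · exact hn
    · simp [dtmcInit] at hd
    · simp [dtmcInit] at hd

theorem valueLaw_dtmcInit (ε : PosReal) (inp : P.InVal) :
    (P.dtmcInit inp).valueLaw ε = Measure.dirac 0 := by
  rw [DState.valueLaw, dtmcInit_solve, Measure.map_id, DState.noise_eq]
  have h1 : (P.dtmcInit inp).intNoise ε = fun _ => Measure.dirac 0 := rfl
  have h2 : (P.dtmcInit inp).realNoise ε = fun _ => Measure.dirac 0 := rfl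
  rw [h1, h2, pi_dirac, pi_dirac, Measure.dirac_prod_dirac]
  rfl

theorem weight_dtmcInit (ε : PosReal) (inp : P.InVal) : (P.dtmcInit inp).weight ε = 1 := by
  have := (P.wellFormed_dtmcInit inp).isProbabilityMeasure ε
  have h : DState.sat (P.dtmcInit inp).conds = Set.univ := by
    ext v
    simp [DState.sat, dtmcInit]
  rw [DState.weight, h, measure_univ]

theorem expect_dtmcInit (ε : PosReal) (inp : P.InVal) {f : NState σ → ℝ≥0∞} (hf : Measurable f) :
    (P.dtmcInit inp).expect ε f = f (P.natInit inp) := by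
  have h : DState.sat (P.dtmcInit inp).conds = Set.univ := by
    ext v
    simp [DState.sat, dtmcInit]
  rw [DState.expect, weight_dtmcInit, h, Measure.restrict_univ, valueLaw_dtmcInit, inv_one, one_mul]
  refine (lintegral_dirac' _ (hf.comp (P.dtmcInit inp).measurable_toNState)).trans ?_
  refine congrArg f ?_
  refine Prod.ext (Prod.ext rfl (Prod.ext rfl (Prod.ext ?_ rfl))) rfl
  funext x
  simp only [DState.toNState, DState.domVal, dtmcInit, natInit]
  split_ifs <;> rfl

theorem assignedIn_insert (l : σ.Label) (L : Set σ.Label) :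
    P.assignedIn (insert l L) = P.assignedIn L ∪ {v | P.AssignsAt l v} := by
  ext v
  simp only [assignedIn, Set.mem_insert_iff, exists_eq_or_imp, Set.mem_ofPred_eq, Set.mem_union]
  rw [or_comm (a := P.AssignsAt l v), or_assoc]

/-! ### The mixture formula for executions -/

open Classical in
/-- A function of the last state of an execution and of the variables that have been assigned, on
the executions that do not terminate before their last state. -/
def runValue (G : NState σ → Set (Var σ) → ℝ≥0∞) {i : ℕ} (α : Fin (i + 1) → NState σ) : ℝ≥0∞ :=
  if ∃ l ∈ pastLabels α, P.IsExit l then 0 else G (α (Fin.last i)) (P.assignedIn (pastLabels α))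

theorem measurable_runValue {G : NState σ → Set (Var σ) → ℝ≥0∞} (hG : ∀ A, Measurable (G · A))
    (i : ℕ) : Measurable (P.runValue G (i := i)) := by
  classical
  refine measurable_last_pastLabels (i := i)
    (g := fun s L => if ∃ l ∈ L, P.IsExit l then 0 else G s (P.assignedIn L)) fun L => ?_
  by_cases h : ∃ l ∈ L, P.IsExit l
  · simp only [h, if_true]; exact measurable_const
  · simp only [h, if_false]; exact hG _

open Classical in
/-- The expectation of a function after one further step. -/
def nextValue (ε : PosReal) (G : NState σ → Set (Var σ) → ℝ≥0∞) (s : NState σ) (A : Set (Var σ)) :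
    ℝ≥0∞ :=
  if P.IsExit s.label then 0
  else ∫⁻ s', G s' (A ∪ {v | P.AssignsAt s.label v}) ∂(P.natStep ε s)

theorem measurable_nextValue (ε : PosReal) {G : NState σ → Set (Var σ) → ℝ≥0∞}
    (hG : ∀ A, Measurable (G · A)) (A : Set (Var σ)) : Measurable (P.nextValue ε G · A) := by
  classical
  -- The label is split off as a separate argument from a countable set; for a fixed label, both the
  -- test for `exit` and the set of assigned variables are constant.
  have h : Measurable fun p : NState σ × σ.Label => if P.IsExit p.2 then (0 : ℝ≥0∞)
      else ∫⁻ s', G s' (A ∪ {v | P.AssignsAt p.2 v}) ∂(P.natStep ε p.1) := by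
    refine measurable_from_prod_countable_left fun l => ?_
    by_cases hl : P.IsExit l
    · simp only [hl, if_true]; exact measurable_const
    · simp only [hl, if_false]
      exact (Measure.measurable_lintegral (hG _)).comp (P.measurable_natStep ε)
  exact h.comp (measurable_id.prodMk measurable_label)

/-- The Markov property. The last label of the shorter execution becomes a past label of the longer
one, so `nextValue` has to test it for `exit` and add the variable it assigns. -/
theorem lintegral_runValue_succ (ε : PosReal) (inp : P.InVal) {G : NState σ → Set (Var σ) → ℝ≥0∞}
    (hG : ∀ A, Measurable (G · A)) (i : ℕ) :
    ∫⁻ α, P.runValue G α ∂(P.execLaw ε inp (i + 1)) =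
      ∫⁻ α, P.runValue (P.nextValue ε G) α ∂(P.execLaw ε inp i) := by
  classical
  rw [P.lintegral_execLaw_succ ε inp i (P.measurable_runValue hG (i + 1))]
  refine lintegral_congr fun α => ?_
  simp only [runValue, pastLabels_snoc, Fin.snoc_last, assignedIn_insert, nextValue,
    Set.mem_insert_iff, exists_eq_or_imp]
  by_cases h1 : P.IsExit (α (Fin.last i)).label
  · simp [h1]
  · by_cases h2 : ∃ l ∈ pastLabels α, P.IsExit l
    · simp [h2]
    · simp only [h1, h2, or_self, if_false]

/-- The states of the DTMC semantics that are visited with positive probability, and the law of the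
executions in terms of them. -/
structure Correspondence (ε : PosReal) (inp : P.InVal) (i : ℕ) : Prop where
  wellFormed : ∀ z, P.visitProb ε inp i z ≠ 0 → z.WellFormed
  weight_ne_zero : ∀ z, P.visitProb ε inp i z ≠ 0 → z.weight ε ≠ 0
  lintegral_eq : ∀ G : NState σ → Set (Var σ) → ℝ≥0∞, (∀ A, Measurable (G · A)) →
    ∫⁻ α, P.runValue G α ∂(P.execLaw ε inp i) =
      ∑' z, P.visitProb ε inp i z * z.expect ε (G · z.defined)

variable {P} {ε : PosReal} {inp : P.InVal}

theorem Correspondence.zero : P.Correspondence ε inp 0 where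
  wellFormed z hz := by
    obtain rfl : z = P.dtmcInit inp := by simpa [visitProb] using hz
    exact P.wellFormed_dtmcInit inp
  weight_ne_zero z hz := by
    obtain rfl : z = P.dtmcInit inp := by simpa [visitProb] using hz
    rw [P.weight_dtmcInit]
    exact one_ne_zero
  lintegral_eq G hG := by
    rw [tsum_eq_single (P.dtmcInit inp) fun z hz => by simp [visitProb, hz]]
    simp only [visitProb, if_true, one_mul]
    rw [P.expect_dtmcInit ε inp (hG _), P.defined_dtmcInit, execLaw,
      lintegral_dirac' _ (P.measurable_runValue hG 0)]
    simp [runValue, pastLabels]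

/-- The mixture formula is applied to the indicator of a read of an unassigned variable. The
integral over executions vanishes by hypothesis, hence so does each term of the sum; a visited state
violating the claim would contribute its full visit probability. -/
theorem Correspondence.readsAt_subset {i : ℕ} (h : P.Correspondence ε inp i)
    (hP' : P.AssignedBeforeUse ε inp) {z : DState P} (hz : P.visitProb ε inp i z ≠ 0) :
    P.readsAt z.label ⊆ z.defined := by
  classical
  let G : NState σ → Set (Var σ) → ℝ≥0∞ := fun s A => if P.readsAt s.label ⊆ A then 0 else 1
  have hG : ∀ A, Measurable (G · A) := fun A =>
    (Measurable.of_discrete (f := fun l : σ.Label =>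
      if P.readsAt l ⊆ A then (0 : ℝ≥0∞) else 1)).comp measurable_label
  have h0 : ∫⁻ α, P.runValue G α ∂(P.execLaw ε inp i) = 0 := by
    rw [lintegral_eq_zero_iff (P.measurable_runValue hG i)]
    filter_upwards [hP' i] with α hα
    have hsub : P.readsAt (α (Fin.last i)).label ⊆ P.assignedIn (pastLabels α) := by
      intro v hv
      rcases hα (Fin.last i) v hv with hx | ⟨k, hk, ha⟩
      · exact .inl hx
      -- Since `k` precedes the last index, its label is one of the past labels.
      · refine .inr ⟨_, ⟨k.castPred hk.ne, rfl⟩, ?_⟩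
        simpa using ha
    simp [runValue, G, hsub]
  rw [h.lintegral_eq G hG, ENNReal.tsum_eq_zero] at h0
  by_contra hn
  have h1 := h0 z
  have h2 : z.expect ε (G · z.defined) = z.expect ε fun _ => 1 := by
    have : ∀ v, G (z.toNState v) z.defined = 1 := fun v => if_neg hn
    simp only [DState.expect, this]
  rw [h2, DState.expect_const (h.wellFormed z hz) (h.weight_ne_zero z hz), mul_one] at h1
  exact hz h1

/-- One kernel step is moved into the function by `lintegral_runValue_succ`, the formula for `i` is
applied, and the simulation replaces that step by a DTMC step at each visited state. -/
theorem Correspondence.succ (hP : P.IsDiPWhile) (hP' : P.AssignedBeforeUse ε inp) {i : ℕ}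
    (h : P.Correspondence ε inp i) : P.Correspondence ε inp (i + 1) := by
  classical
  have hsim : ∀ z, P.visitProb ε inp i z ≠ 0 → ¬ P.IsExit z.label → z.Simulates ε := fun z hz he =>
    DState.simulates hP (h.wellFormed z hz) (h.weight_ne_zero z hz) he (h.readsAt_subset hP' hz)
  have hsucc : ∀ z', P.visitProb ε inp (i + 1) z' ≠ 0 → ∃ z : DState P, z.IsSuccessor ε z' := by
    intro z' hz'
    rw [visitProb, Ne, ENNReal.tsum_eq_zero, not_forall] at hz'
    obtain ⟨z, hz⟩ := hz'
    split_ifs at hz with he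
    · exact absurd rfl hz
    · exact ⟨z, (hsim z (left_ne_zero_of_mul hz) he).1 z' (right_ne_zero_of_mul hz)⟩
  refine ⟨fun z' hz' => (hsucc z' hz').elim fun _ h => h.wellFormed,
    fun z' hz' => (hsucc z' hz').elim fun _ h => h.weight_ne_zero, fun G hG => ?_⟩
  rw [P.lintegral_runValue_succ ε inp hG, h.lintegral_eq _ (P.measurable_nextValue ε hG)]
  simp only [visitProb, ← ENNReal.tsum_mul_right]
  rw [ENNReal.tsum_comm]
  refine tsum_congr fun z => ?_
  by_cases he : P.IsExit z.label
  · have hv : ∀ v, P.nextValue ε G (z.toNState v) z.defined = 0 := fun v => if_pos he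
    simp only [DState.expect, hv, lintegral_zero, mul_zero, he, if_true, zero_mul, tsum_zero]
  -- States that are not visited need not be well formed; they are discarded because their
  -- probability is zero.
  · by_cases hz : P.visitProb ε inp i z = 0
    · simp [hz]
    · have hv : z.expect ε (P.nextValue ε G · z.defined) = z.expect ε fun s =>
          ∫⁻ s', G s' (z.defined ∪ {v | P.AssignsAt z.label v}) ∂(P.natStep ε s) := by
        have : ∀ v, P.nextValue ε G (z.toNState v) z.defined =
            ∫⁻ s', G s' (z.defined ∪ {v | P.AssignsAt z.label v}) ∂(P.natStep ε (z.toNState v)) :=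
          fun v => if_neg he
        simp only [DState.expect, this]
      rw [hv, (hsim z hz he).2 _ (hG _), ← ENNReal.tsum_mul_left]
      refine tsum_congr fun z' => ?_
      rw [if_neg he, mul_assoc]
      by_cases hs : z.step ε z' = 0
      · simp [hs]
      -- The set of assigned variables carried along the execution agrees with the set of variables
      -- defined in the successor.
      · rw [((hsim z hz he).1 z' hs).defined_eq]

theorem correspondence (hP : P.IsDiPWhile) (hP' : P.AssignedBeforeUse ε inp) (i : ℕ) :
    P.Correspondence ε inp i := by
  induction i with
  | zero => exact .zero
  | succ i ih => exact ih.succ hP hP'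

/-! ### Output probabilities -/

open Classical in
/-- The indicator function of termination with the output `out`. -/
def outputIndicator (P : Program σ) (out : P.OutVal) (s : NState σ) : ℝ≥0∞ :=
  if P.IsExit s.label ∧ ∀ x : P.outputs, s.domVal x = out x then 1 else 0

theorem measurable_outputIndicator (P : Program σ) (out : P.OutVal) :
    Measurable (P.outputIndicator out) := by
  classical
  exact (Measurable.of_discrete (f := fun d : DiscState σ =>
    if P.IsExit d.1 ∧ ∀ x : P.outputs, d.2.2.1 x = out x then (1 : ℝ≥0∞) else 0)).comp
      measurable_fst

theorem execLaw_required (P : Program σ) (ε : PosReal) (inp : P.InVal) (out : P.OutVal) (i : ℕ) :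
    P.execLaw ε inp i (P.required out i) =
      ∫⁻ α, P.runValue (fun s _ => P.outputIndicator out s) α ∂(P.execLaw ε inp i) := by
  classical
  have hind : (P.runValue (i := i) fun s _ => P.outputIndicator out s) =
      (P.required out i).indicator 1 := by
    funext α
    simp only [runValue, outputIndicator, pastLabels, Set.exists_range_iff, Set.indicator_apply,
      required,
      Set.mem_ofPred_eq, Pi.one_apply]
    by_cases h1 : ∃ j : Fin i, P.IsExit (α j.castSucc).label
    · rw [if_pos h1, if_neg]
      rintro ⟨-, -, h⟩
      exact h1.elim fun j hj => h j hj
    · rw [if_neg h1]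
      push Not at h1
      simp [h1]
  -- Measurability of the event is read off from that of its indicator.
  have hms : MeasurableSet (P.required out i) := by
    have h := P.measurable_runValue (G := fun s _ => P.outputIndicator out s)
      (fun _ => P.measurable_outputIndicator out) i
    rw [hind] at h
    convert h (measurableSet_singleton 1) using 1
    ext α
    by_cases hα : α ∈ P.required out i <;> simp [hα]
  rw [hind, lintegral_indicator_one hms]

/-- The two series agree term by term. The output indicator depends only on the label and the `DOM`
values, hence is constant on the conditional law of a state, and its expectation is that constant.
-/
theorem probDTMC_eq_probNatural (hP : P.IsDiPWhile) (hP' : P.AssignedBeforeUse ε inp)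
    (out : P.OutVal) : P.probDTMC ε inp out = P.probNatural ε inp out := by
  classical
  rw [probDTMC_eq_tsum, probNatural]
  refine tsum_congr fun i => ?_
  have h := correspondence hP hP' i
  rw [execLaw_required, h.lintegral_eq _ fun _ => P.measurable_outputIndicator out]
  refine tsum_congr fun z => ?_
  by_cases hz : P.visitProb ε inp i z = 0
  · simp [hz]
  · congr 1
    refine Eq.trans ?_ (DState.expect_const (h.wellFormed z hz) (h.weight_ne_zero z hz)
      (if P.IsExit z.label ∧ ∀ x : P.outputs, z.domVal x = out x then 1 else 0)).symm
    have hr := h.readsAt_subset hP' hz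
    congr 1
    refine propext (and_congr_right fun he => forall_congr' fun x => ?_)
    -- An `exit` refers to the output variables, so these have a value in `z`. Otherwise the default
    -- `0` could match `out` in the kernel semantics while the DTMC target requires a defined value.
    have hx : (z.fX x).isSome := by
      refine hr (show Var.dom x.1 ∈ _ from ?_)
      unfold readsAt
      rw [show P.instr z.label = .exit from he]
      exact ⟨x.1, x.2, rfl⟩
    obtain ⟨d, hd⟩ := Option.isSome_iff_exists.mp hx
    simp [DState.domVal, hd]

end Program

end

end DP

theorem mainTheorem4 (σ : DP.Sig) (P : DP.Program σ) (hP : P.IsDiPWhile) (ε : DP.PosReal)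
    (inp : P.InVal) (out : P.OutVal) (hP' : P.AssignedBeforeUse ε inp) :
    P.probDTMC ε inp out = P.probNatural ε inp out :=
  DP.Program.probDTMC_eq_probNatural hP hP' out
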